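/- **Theorem 6.3.** Let $E=(E^0,E^1,r,d)$ be a finite directed graph without sources (every vertex is the range of some edge), let $G$ be a discrete group acting on $E$ by graph automorphisms, and let $\varphi:G\times E^1\to G$ satisfy $\varphi(gh,e)=\varphi(g,he)\varphi(h,e)$ and $\varphi(g,e)x=gx$ for all $g,h\in G$, $e\in E^1$, $x\in E^0$. A path of length $n\ge 1$ is $\alpha=\alpha_1\cdots\alpha_n$ with $\alpha_i\in E^1$, $d(\alpha_i)=r(\alpha_{i+1})$, and $r(\alpha)=r(\alpha_1)$, $d(\alpha)=d(\alpha_n)$; vertices $x$ are the paths of length $0$, with $r(x)=d(x)=x$. Let $E^*$ be the set of finite paths. The action and the cocycle are extended to $E^*$ by $\varphi(g,x)=g$ for vertices $x$, and $g(e\alpha)=(ge)(\varphi(g,e)\alpha)$, $\varphi(g,e\alpha)=\varphi(\varphi(g,e),\alpha)$. Let $\mathcal O_{G,E}$ be the universal unital C*-algebra generated by elements $p_x$ ($x\in E^0$), $s_e$ ($e\in E^1$), $u_g$ ($g\in G$) such that: the $p_x$ are mutually orthogonal projections with $\sum_{x\in E^0}p_x=1$; the $s_e$ are partial isometries with $s_e^*s_e=p_{d(e)}$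 and $p_x=\sum_{r(e)=x}s_es_e^*$; $g\mapsto u_g$ is a unitary representation; $u_gs_e=s_{ge}u_{\varphi(g,e)}$; and $u_gp_x=p_{gx}u_g$. For a path put $s_x=p_x$ if $x$ is a vertex and $s_\alpha=s_{\alpha_1}\cdots s_{\alpha_n}$ if $\alpha=\alpha_1\cdots\alpha_n$, $n\ge1$. Let $\mathcal S_{G,E}=\{(\alpha,g,\beta)\in E^*\times G\times E^*: d(\alpha)=g\,d(\beta)\}\cup\{0\}$ be the inverse semigroup with zero whose adjoint is $(\alpha,g,\beta)^*=(\beta,g^{-1},\alpha)$ and whose product is $$(\alpha,g,\beta)(\gamma,h,\delta)=\begin{cases}(\alpha\, g\varepsilon,\ \varphi(g,\varepsilon)h,\ \delta)&\text{if }\gamma=\beta\varepsilon,\\ (\alpha,\ g\varphi(h^{-1},\varepsilon)^{-1},\ \delta\, h^{-1}\varepsilon)&\text{if }\beta=\gamma\varepsilon,\\ 0&\text{otherwise.}\end{cases}$$ A representation of an inverse semigroup with zero $\mathcal S$ in a unital C*-algebra $A$ is a multiplicative, adjoint-preserving map $\rho:\mathcal S\to A$ with $\rho(0)=0$. Let $\mathcal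 E$ be the idempotent semilattice of $\mathcal S$. The representation $\rho$ is tight if for all finite $X,Y\subseteq\mathcal E$ and every finite cover $Z$ of $\mathcal E^{X,Y}=\{z\in\mathcal E: z\le x\ \forall x\in X,\ zy=0\ \forall y\in Y\}$ (that is, a finite set $Z\subseteq\mathcal E^{X,Y}$ such that every nonzero $w\in\mathcal E^{X,Y}$ satisfies $wz\ne0$ for some $z\in Z$) one has $$\bigvee_{z\in Z}\rho(z)\ \ge\ \bigwedge_{x\in X}\rho(x)\wedge\bigwedge_{y\in Y}\bigl(1-\rho(y)\bigr),$$ where $\vee,\wedge$ are taken among the commuting projections generated by $\rho(\mathcal E)$, and empty infima and suprema are $1$ and $0$. Then the map $\pi:\mathcal S_{G,E}\to\mathcal O_{G,E}$, $\pi(0)=0$, $\pi(\alpha,g,\beta)=s_\alpha u_gs_\beta^*$, is a tight representation. Moreover, for every unital C*-algebra $A$ and every tight representation $\rho:\mathcal S_{G,E}\to A$ there exists a unique unital $*$-homomorphism $\psi:\mathcal O_{G,E}\to A$ such that $\psi\circ\pi=\rho$. -/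

import Mathlib

universe u₁ u₂ u₃ w

/-! ## Inverse semigroups with zero and tight representations -/

/-- An inverse semigroup with zero: a regular semigroup with zero, with commuting idempotents;
`star s` is the (unique) generalized inverse of `s`. -/
class InverseSemigroupWithZero (S : Type*) extends SemigroupWithZero S, Star S where
  mul_star_mul : ∀ s : S, s * star s * s = s
  star_mul_star : ∀ s : S, star s * s * star s = star s
  idem_comm : ∀ e f : S, IsIdempotentElem e → IsIdempotentElem f → e * f = f * e

/-- The idempotents of an inverse semigroup. -/
def Idem (S : Type*) [InverseSemigroupWithZero S] : Type _ := {e : S // IsIdempotentElem e}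

namespace Idem

variable {S : Type*} [InverseSemigroupWithZero S]

/-- The idempotent semilattice: `e ≤ f` iff `e * f = e`, and `e ⊓ f = e * f`. -/
instance : SemilatticeInf (Idem S) where
  le e f := e.1 * f.1 = e.1
  le_refl e := e.2
  le_trans e f g h1 h2 := by
    rw [← h1, mul_assoc, h2]
  le_antisymm e f h1 h2 := by
    apply Subtype.ext
    rw [← h1, InverseSemigroupWithZero.idem_comm _ _ e.2 f.2, h2]
  inf e f := ⟨e.1 * f.1, by
    change e.1 * f.1 * (e.1 * f.1) = e.1 * f.1
    rw [mul_assoc, ← mul_assoc f.1, InverseSemigroupWithZero.idem_comm _ _ f.2 e.2,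
      mul_assoc e.1, f.2.eq, ← mul_assoc, e.2.eq]⟩
  inf_le_left e f := by
    change e.1 * f.1 * e.1 = e.1 * f.1
    rw [mul_assoc, InverseSemigroupWithZero.idem_comm _ _ f.2 e.2, ← mul_assoc, e.2.eq]
  inf_le_right e f := by
    change e.1 * f.1 * f.1 = e.1 * f.1
    rw [mul_assoc, f.2.eq]
  le_inf e f g h1 h2 := by
    change e.1 * (f.1 * g.1) = e.1
    rw [← mul_assoc, h1, h2]

instance : OrderBot (Idem S) where
  bot := ⟨0, zero_mul 0⟩
  bot_le e := zero_mul e.1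

end Idem

section Tight

variable {L : Type*} [SemilatticeInf L] [OrderBot L]

/-- The elements of `L` that lie below every `x ∈ X` and are orthogonal to every `y ∈ Y`. -/
def relativeCut (X Y : Finset L) : Set L :=
  {z | (∀ x ∈ X, z ≤ x) ∧ ∀ y ∈ Y, z ⊓ y = ⊥}

/-- `Z` is a cover for `F`: it is a subset of `F`, and every nonzero element of `F` meets some
element of `Z`. -/
def IsCover (Z F : Set L) : Prop :=
  Z ⊆ F ∧ ∀ y ∈ F, y ≠ ⊥ → ∃ z ∈ Z, z ⊓ y ≠ ⊥

/-- Tightness of a map from a semilattice with zero to a Boolean algebra; an empty infimum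
is `⊤`, an empty supremum is `⊥`. -/
def IsTightMap {B : Type*} [BooleanAlgebra B] (β : L → B) : Prop :=
  ∀ X Y Z : Finset L, IsCover (Z : Set L) (relativeCut X Y) →
    X.inf β ⊓ Y.inf (fun y => (β y)ᶜ) ≤ Z.sup β

end Tight

/-- A representation of an inverse semigroup with zero in a unital C*-algebra. -/
structure IsRepresentation {S A : Type*} [InverseSemigroupWithZero S] [CStarAlgebra A]
    (ρ : S → A) : Prop where
  map_zero : ρ 0 = 0
  map_mul : ∀ s t, ρ (s * t) = ρ s * ρ t
  map_star : ∀ s, ρ (star s) = star (ρ s)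

section TightRep

variable {S A : Type*} [InverseSemigroupWithZero S] [CStarAlgebra A]

/-- The unital subalgebra of `A` generated by the projections `ρ e`, for `e` an idempotent. -/
def IsRepresentation.idemAlgebra {ρ : S → A} (_ : IsRepresentation ρ) : Subalgebra ℂ A :=
  Algebra.adjoin ℂ (Set.range fun e : Idem S => ρ e.1)

/-- It is commutative, because idempotents of an inverse semigroup commute. -/
instance {ρ : S → A} (h : IsRepresentation ρ) : CommRing h.idemAlgebra where
  mul_comm := by
    have : IsMulCommutative (Algebra.adjoin ℂ (Set.range fun e : Idem S => ρ e.1)) := by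
      apply Algebra.isMulCommutative_adjoin
      rintro _ ⟨e, rfl⟩ _ ⟨f, rfl⟩
      simp only [← h.map_mul, InverseSemigroupWithZero.idem_comm _ _ e.2 f.2]
    exact this.is_comm.comm

/-- The idempotents of the commutative algebra generated by the commuting projections `ρ e`; they
form a Boolean algebra, with `p ⊓ q = p * q`, `p ⊔ q = p + q - p * q` and `pᶜ = 1 - p`. -/
abbrev IsRepresentation.Proj {ρ : S → A} (h : IsRepresentation ρ) : Type _ :=
  {a : h.idemAlgebra // IsIdempotentElem a}

/-- The restriction of a representation to the idempotent semilattice. -/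
def IsRepresentation.onIdem {ρ : S → A} (h : IsRepresentation ρ) (e : Idem S) : h.Proj :=
  ⟨⟨ρ e.1, Algebra.subset_adjoin ⟨e, rfl⟩⟩, by
    apply Subtype.ext
    change ρ e.1 * ρ e.1 = ρ e.1
    rw [← h.map_mul, e.2.eq]⟩

/-- A representation is tight if its restriction to the idempotent semilattice, a map into a
Boolean algebra of projections, is tight. -/
def IsTightRepresentation (ρ : S → A) : Prop :=
  ∃ h : IsRepresentation ρ, IsTightMap h.onIdem

end TightRep

/-! ## Self-similar graphs and their finite paths -/

/-- A directed graph without sources, with vertex set `V`, edge set `W`, range map `r` and domain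
map `d`, on which `G` acts by graph automorphisms, together with a one-cocycle `φ : G × W → G`
satisfying `φ(g,e) x = g x` for all vertices `x`. -/
structure SelfSimilarGraph (G V W : Type*) [Group G] [MulAction G V] [MulAction G W] where
  r : W → V
  d : W → V
  φ : G → W → G
  no_sources : ∀ x, ∃ e, r e = x
  r_smul : ∀ (g : G) (e : W), r (g • e) = g • r e
  d_smul : ∀ (g : G) (e : W), d (g • e) = g • d e
  φ_mul : ∀ (g h : G) (e : W), φ (g * h) e = φ g (h • e) * φ h e
  φ_smul : ∀ (g : G) (e : W) (x : V), φ g e • x = g • x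

namespace SelfSimilarGraph

variable {G V W : Type*} [Group G] [MulAction G V] [MulAction G W] (D : SelfSimilarGraph G V W)

/-- `e₁ e₂ ⋯ eₙ` is a path with range `x`: `r e₁ = x` and `d eᵢ = r eᵢ₊₁`. -/
def IsPath : V → List W → Prop
  | _, [] => True
  | x, e :: l => D.r e = x ∧ IsPath (D.d e) l

/-- The source of the path with range `x` and edges `l`. -/
def listSource : V → List W → V
  | x, [] => x
  | _, e :: l => listSource (D.d e) l

/-- The action of `G` on lists of edges: `g (e l) = (g e) (φ(g,e) l)`. -/
def listSMul : G → List W → List W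
  | _, [] => []
  | g, e :: l => (g • e) :: listSMul (D.φ g e) l

/-- The cocycle on lists of edges: `φ(g, e l) = φ(φ(g,e), l)`. -/
def listCocycle : G → List W → G
  | g, [] => g
  | g, e :: l => listCocycle (D.φ g e) l

/-- Finite paths. A path of length zero is a vertex. -/
@[ext] structure Path where
  range : V
  edges : List W
  isPath : D.IsPath range edges

variable {D}

theorem φ_one (e : W) : D.φ 1 e = 1 := by
  have h := D.φ_mul 1 1 e
  rw [one_mul, one_smul] at h
  exact left_eq_mul.mp h

theorem IsPath.append {l l' : List W} : ∀ {x : V}, D.IsPath x l →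
    D.IsPath (D.listSource x l) l' → D.IsPath x (l ++ l') := by
  induction l with
  | nil => intro x _ h; exact h
  | cons e l ih => intro x h h'; exact ⟨h.1, ih h.2 h'⟩

theorem listSource_append (l l' : List W) : ∀ x : V,
    D.listSource x (l ++ l') = D.listSource (D.listSource x l) l' := by
  induction l with
  | nil => intro x; rfl
  | cons e l ih => intro x; exact ih _

theorem IsPath.listSMul {l : List W} : ∀ {x : V}, D.IsPath x l → ∀ g : G,
    D.IsPath (g • x) (D.listSMul g l) := by
  induction l with
  | nil => intro x _ g; trivial
  | cons e l ih =>
    intro x h g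
    refine ⟨by rw [D.r_smul, h.1], ?_⟩
    have := ih h.2 (D.φ g e)
    rwa [D.φ_smul, ← D.d_smul] at this

theorem listSource_listSMul (l : List W) : ∀ (x : V) (g : G),
    D.listSource (g • x) (D.listSMul g l) = g • D.listSource x l := by
  induction l with
  | nil => intro x g; rfl
  | cons e l ih =>
    intro x g
    have := ih (D.d e) (D.φ g e)
    rwa [D.φ_smul, D.φ_smul, ← D.d_smul] at this

theorem listCocycle_smul (l : List W) : ∀ (g : G) (x : V), D.listCocycle g l • x = g • x := by
  induction l with
  | nil => intro g x; rfl
  | cons e l ih => intro g x; exact (ih _ x).trans (D.φ_smul g e x)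

theorem listSMul_append (l l' : List W) : ∀ g : G,
    D.listSMul g (l ++ l') = D.listSMul g l ++ D.listSMul (D.listCocycle g l) l' := by
  induction l with
  | nil => intro g; rfl
  | cons e l ih => intro g; exact congrArg _ (ih _)

theorem listCocycle_append (l l' : List W) : ∀ g : G,
    D.listCocycle g (l ++ l') = D.listCocycle (D.listCocycle g l) l' := by
  induction l with
  | nil => intro g; rfl
  | cons e l ih => intro g; exact ih _

theorem listSMul_mul (l : List W) : ∀ g h : G,
    D.listSMul (g * h) l = D.listSMul g (D.listSMul h l) := by
  induction l with
  | nil => intro g h; rfl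
  | cons e l ih =>
    intro g h
    simp only [SelfSimilarGraph.listSMul, D.φ_mul, ih, mul_smul]

theorem listCocycle_mul (l : List W) : ∀ g h : G,
    D.listCocycle (g * h) l = D.listCocycle g (D.listSMul h l) * D.listCocycle h l := by
  induction l with
  | nil => intro g h; rfl
  | cons e l ih =>
    intro g h
    simp only [SelfSimilarGraph.listSMul, listCocycle, D.φ_mul, ih]

theorem listSMul_one (l : List W) : D.listSMul 1 l = l := by
  induction l with
  | nil => rfl
  | cons e l ih => simp only [SelfSimilarGraph.listSMul, φ_one, ih, one_smul]

theorem listCocycle_one (l : List W) : D.listCocycle 1 l = 1 := by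
  induction l with
  | nil => rfl
  | cons e l ih => simp only [listCocycle, φ_one, ih]

namespace Path

/-- The source (domain) of a path. -/
def source (α : D.Path) : V := D.listSource α.range α.edges

/-- Concatenation of composable paths. -/
def concat (α β : D.Path) (h : α.source = β.range) : D.Path where
  range := α.range
  edges := α.edges ++ β.edges
  isPath := α.isPath.append (by
    have := β.isPath
    rwa [← h] at this)

/-- The action of `G` on paths. -/
def smul (g : G) (α : D.Path) : D.Path := ⟨g • α.range, D.listSMul g α.edges, α.isPath.listSMul g⟩

/-- The cocycle on paths. -/
def cocycle (g : G) (α : D.Path) : G := D.listCocycle g α.edges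

theorem source_concat (α β : D.Path) (h : α.source = β.range) :
    (α.concat β h).source = β.source := by
  simp only [source, concat, listSource_append]
  congr 1

theorem source_smul (g : G) (α : D.Path) : (α.smul g).source = g • α.source :=
  listSource_listSMul _ _ _

theorem cocycle_smul (g : G) (α : D.Path) (x : V) : α.cocycle g • x = g • x :=
  listCocycle_smul _ _ _

theorem smul_mul (g h : G) (α : D.Path) : α.smul (g * h) = (α.smul h).smul g :=
  Path.ext (mul_smul _ _ _) (listSMul_mul _ _ _)

theorem smul_one (α : D.Path) : α.smul 1 = α := Path.ext (one_smul _ _) (listSMul_one _)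

theorem cocycle_mul (g h : G) (α : D.Path) :
    α.cocycle (g * h) = (α.smul h).cocycle g * α.cocycle h := listCocycle_mul _ _ _

theorem cocycle_one (α : D.Path) : α.cocycle 1 = 1 := listCocycle_one _

theorem cocycle_concat (g : G) (α β : D.Path) (h : α.source = β.range) :
    (α.concat β h).cocycle g = β.cocycle (α.cocycle g) := listCocycle_append _ _ _

theorem concat_left_cancel {α β γ : D.Path} {h : α.source = β.range} {h' : α.source = γ.range}
    (e : α.concat β h = α.concat γ h') : β = γ :=
  Path.ext (h.symm.trans h') (List.append_cancel_left (congrArg Path.edges e))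

/-- The path of length zero at the vertex `x`. -/
def vertex (D : SelfSimilarGraph G V W) (x : V) : D.Path := ⟨x, [], trivial⟩

theorem concat_vertex (α : D.Path) : α.concat (vertex D α.source) rfl = α :=
  Path.ext rfl (List.append_nil _)

end Path

/-! ## The inverse semigroup of a self-similar graph -/

/-- The triples `(α, g, β)` with `d(α) = g d(β)`, and a zero. -/
inductive InvSemigroup (D : SelfSimilarGraph G V W) : Type _
  | zero : InvSemigroup D
  | triple (α : D.Path) (g : G) (β : D.Path) (h : α.source = g • β.source) : InvSemigroup D

namespace InvSemigroup

instance : Zero D.InvSemigroup := ⟨zero⟩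

/-- `(α, g, β)* = (β, g⁻¹, α)`, and `0* = 0`. -/
instance : Star D.InvSemigroup where
  star
    | zero => zero
    | triple α g β h => triple β g⁻¹ α (by rw [h, inv_smul_smul])

theorem mul_aux {g : G} {α β ε : D.Path} (h : α.source = g • β.source)
    (h' : β.source = ε.range) : α.source = (ε.smul g).range := by rw [h, h']; rfl

theorem mul_aux₁ {g k : G} {α β δ ε : D.Path} (h : α.source = g • β.source)
    (h' : β.source = ε.range) (h₂ : (β.concat ε h').source = k • δ.source) :
    (α.concat (ε.smul g) (mul_aux h h')).source = (ε.cocycle g * k) • δ.source := by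
  rw [Path.source_concat] at *
  rw [Path.source_smul, h₂, mul_smul, Path.cocycle_smul]

theorem mul_aux₂ {g k : G} {α γ δ ε : D.Path} (h' : γ.source = ε.range)
    (h : α.source = g • (γ.concat ε h').source) (h₂ : δ.source = k⁻¹ • γ.source) :
    α.source = (g * (ε.cocycle k⁻¹)⁻¹) •
      (δ.concat (ε.smul k⁻¹) (mul_aux h₂ h')).source := by
  rw [Path.source_concat] at *
  rw [Path.source_smul, h, mul_smul, ← Path.cocycle_smul k⁻¹ ε, inv_smul_smul]

theorem inv_rel {k : G} {γ δ : D.Path} (h : γ.source = k • δ.source) :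
    δ.source = k⁻¹ • γ.source := by rw [h, inv_smul_smul]

open Classical in
/-- The product of `(α, g, β)` and `(γ, k, δ)` is
`(α gε, φ(g,ε)k, δ)` if `γ = βε`, it is `(α, gφ(k⁻¹,ε)⁻¹, δ k⁻¹ε)` if `β = γε`,
and `0` in all other cases. -/
noncomputable def mul : D.InvSemigroup → D.InvSemigroup → D.InvSemigroup
  | zero, _ => zero
  | triple _ _ _ _, zero => zero
  | triple α g β h, triple γ k δ h₂ =>
    if H : ∃ ε : D.Path, ∃ h' : β.source = ε.range, γ = β.concat ε h' then
      let ε := H.choose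
      have h' : β.source = ε.range := H.choose_spec.choose
      triple (α.concat (ε.smul g) (mul_aux h h')) (ε.cocycle g * k) δ
        (mul_aux₁ h h' (by rw [← H.choose_spec.choose_spec, h₂]))
    else if H : ∃ ε : D.Path, ∃ h' : γ.source = ε.range, β = γ.concat ε h' then
      let ε := H.choose
      have h' : γ.source = ε.range := H.choose_spec.choose
      triple α (g * (ε.cocycle k⁻¹)⁻¹) (δ.concat (ε.smul k⁻¹) (mul_aux (inv_rel h₂) h'))
        (mul_aux₂ h' (by rw [← H.choose_spec.choose_spec, h]) (inv_rel h₂))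
    else zero

noncomputable instance : Mul D.InvSemigroup := ⟨mul⟩

theorem triple_congr {α α' β β' : D.Path} {g g' : G} {h : α.source = g • β.source}
    {h' : α'.source = g' • β'.source} (e₁ : α = α') (e₂ : g = g') (e₃ : β = β') :
    triple α g β h = triple α' g' β' h' := by
  subst e₁ e₂ e₃; rfl

theorem triple_mul_left {α β δ ε : D.Path} {g k : G} (h : α.source = g • β.source)
    (h' : β.source = ε.range) (h₂ : (β.concat ε h').source = k • δ.source) :
    triple α g β h * triple (β.concat ε h') k δ h₂ =
      triple (α.concat (ε.smul g) (mul_aux h h')) (ε.cocycle g * k) δ (mul_aux₁ h h' h₂) := by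
  have H : ∃ ε' : D.Path, ∃ h'' : β.source = ε'.range, β.concat ε h' = β.concat ε' h'' :=
    ⟨ε, h', rfl⟩
  have e : H.choose = ε := (Path.concat_left_cancel H.choose_spec.choose_spec).symm
  change mul _ _ = _
  simp only [mul, dif_pos H]
  exact triple_congr (by congr 2) (by rw [e]) rfl

theorem triple_mul_self {α β δ : D.Path} {g k : G} (h : α.source = g • β.source)
    (h₂ : β.source = k • δ.source) :
    triple α g β h * triple β k δ h₂ = triple α (g * k) δ (by rw [h, h₂, mul_smul]) := by
  have hv : β.source = (Path.vertex D β.source).range := rfl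
  have hc : β.concat (Path.vertex D β.source) hv = β := Path.concat_vertex β
  have h₃ : (β.concat (Path.vertex D β.source) hv).source = k • δ.source := by rw [hc, h₂]
  rw [show triple β k δ h₂ = triple (β.concat (Path.vertex D β.source) hv) k δ h₃ from
    triple_congr hc.symm rfl rfl, triple_mul_left h hv h₃]
  exact triple_congr (Path.ext rfl (List.append_nil _)) rfl rfl

theorem triple_mul_right {α γ δ ε : D.Path} {g k : G} (h' : γ.source = ε.range)
    (h : α.source = g • (γ.concat ε h').source) (h₂ : γ.source = k • δ.source) :
    triple α g (γ.concat ε h') h * triple γ k δ h₂ =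
      triple α (g * (ε.cocycle k⁻¹)⁻¹) (δ.concat (ε.smul k⁻¹) (mul_aux (inv_rel h₂) h'))
        (mul_aux₂ h' h (inv_rel h₂)) := by
  change mul _ _ = _
  have H : ∃ ε' : D.Path, ∃ h'' : γ.source = ε'.range, γ.concat ε h' = γ.concat ε' h'' :=
    ⟨ε, h', rfl⟩
  have e : H.choose = ε := (Path.concat_left_cancel H.choose_spec.choose_spec).symm
  by_cases H₁ : ∃ ε' : D.Path, ∃ h'' : (γ.concat ε h').source = ε'.range,
      γ = (γ.concat ε h').concat ε' h''
  · obtain ⟨ε', h'', e'⟩ := H₁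
    have e₁ : γ.edges = γ.edges ++ ε.edges ++ ε'.edges := congrArg Path.edges e'
    rw [List.append_assoc, List.self_eq_append_right, List.append_eq_nil_iff] at e₁
    have hv : γ.concat ε h' = γ := Path.ext rfl
      ((congrArg _ e₁.1).trans (List.append_nil _))
    have hg : α.source = g • γ.source := by rw [h, hv]
    refine Eq.trans (b := triple α g γ hg * triple γ k δ h₂) ?_ ?_
    · exact congrArg (fun s => mul s _) (triple_congr rfl rfl hv)
    · rw [triple_mul_self]
      refine triple_congr rfl ?_ (Path.ext rfl ?_)
      · simp [Path.cocycle, e₁.1, listCocycle]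
      · simp [Path.concat, Path.smul, e₁.1, SelfSimilarGraph.listSMul]
  · simp only [mul, dif_pos H, dif_neg H₁]
    exact triple_congr rfl (by rw [e]) (by congr 2)


theorem triple_mul_eq_zero {α β γ δ : D.Path} {g k : G} (h : α.source = g • β.source)
    (h₂ : γ.source = k • δ.source)
    (H₁ : ¬ ∃ ε : D.Path, ∃ h' : β.source = ε.range, γ = β.concat ε h')
    (H₂ : ¬ ∃ ε : D.Path, ∃ h' : γ.source = ε.range, β = γ.concat ε h') :
    triple α g β h * triple γ k δ h₂ = 0 := by
  change mul _ _ = _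
  simp only [mul, dif_neg H₁, dif_neg H₂]
  rfl

theorem zero_mul' (s : D.InvSemigroup) : 0 * s = 0 := rfl

theorem mul_zero' (s : D.InvSemigroup) : s * 0 = 0 := by cases s <;> rfl

theorem star_star' (s : D.InvSemigroup) : star (star s) = s := by
  cases s with
  | zero => rfl
  | triple α g β h => exact triple_congr rfl (inv_inv g) rfl

/-- The partial bijection of `E* × G` defined by an element of the semigroup:
`(α, g, β)` sends `(βε, k)` to `(α gε, φ(g,ε)k)`. -/
def Rel : D.InvSemigroup → D.Path × G → D.Path × G → Prop
  | zero, _, _ => False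
  | triple α g β h, y, x => ∃ ε : D.Path, ∃ h' : β.source = ε.range,
      x.1 = β.concat ε h' ∧ y.1 = α.concat (ε.smul g) (mul_aux h h') ∧ y.2 = ε.cocycle g * x.2

theorem rel_star (s : D.InvSemigroup) (x y : D.Path × G) : Rel (star s) x y ↔ Rel s y x := by
  have key : ∀ (s : D.InvSemigroup) (x y : D.Path × G), Rel s y x → Rel (star s) x y := by
    intro s x y
    cases s with
    | zero => exact id
    | triple α g β h =>
      rintro ⟨ε, h', e₁, e₂, e₃⟩
      refine ⟨ε.smul g, mul_aux h h', e₂, ?_, ?_⟩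
      · rw [e₁]
        congr 1
        rw [← Path.smul_mul, inv_mul_cancel, Path.smul_one]
      · rw [e₃, ← mul_assoc, ← Path.cocycle_mul, inv_mul_cancel, Path.cocycle_one, one_mul]
  refine ⟨fun h => ?_, key s x y⟩
  have := key _ _ _ h
  rwa [star_star'] at this

theorem rel_functional {s : D.InvSemigroup} {x y y' : D.Path × G} (h : Rel s y x)
    (h' : Rel s y' x) : y = y' := by
  cases s with
  | zero => exact h.elim
  | triple α g β hs =>
    obtain ⟨ε, h₁, e₁, e₂, e₃⟩ := h
    obtain ⟨ε', h₁', e₁', e₂', e₃'⟩ := h'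
    obtain rfl : ε = ε' := Path.concat_left_cancel (e₁.symm.trans e₁')
    exact Prod.ext (e₂.trans e₂'.symm) (e₃.trans e₃'.symm)

theorem rel_base {α β : D.Path} {g : G} (h : α.source = g • β.source) :
    Rel (triple α g β h) (α, g) (β, 1) :=
  ⟨Path.vertex D β.source, rfl, (Path.concat_vertex β).symm,
    Path.ext rfl (List.append_nil _).symm, (mul_one _).symm⟩

theorem rel_inj {s t : D.InvSemigroup} (H : ∀ y x, Rel s y x ↔ Rel t y x) : s = t := by
  cases s with
  | zero =>
    cases t with
    | zero => rfl
    | triple α g β h => exact ((H _ _).2 (rel_base h)).elim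
  | triple α g β h =>
    cases t with
    | zero => exact ((H _ _).1 (rel_base h)).elim
    | triple α' g' β' h' =>
      have h₁ := (H _ _).1 (rel_base h)
      have h₂ := (H _ _).2 (rel_base h')
      have hβ : β = β' := by
        obtain ⟨ε, h₃, e₁, -, -⟩ := h₁
        obtain ⟨ε', h₃', e₁', -, -⟩ := h₂
        change β = β'.concat ε h₃ at e₁
        change β' = β.concat ε' h₃' at e₁'
        have hr : β.range = (β'.concat ε h₃).range := congrArg Path.range e₁
        have hl : β.edges = β'.edges ++ ε.edges := congrArg Path.edges e₁
        have hl' : β'.edges = β.edges ++ ε'.edges := congrArg Path.edges e₁'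
        have hn := congrArg List.length hl
        have hn' := congrArg List.length hl'
        simp only [List.length_append] at hn hn'
        have : ε.edges = [] := List.eq_nil_of_length_eq_zero (by omega)
        exact Path.ext hr (by rw [hl, this, List.append_nil])
      subst hβ
      have := rel_functional h₁ (rel_base h')
      exact triple_congr (congrArg Prod.fst this) (congrArg Prod.snd this) rfl

theorem star_mul' (s t : D.InvSemigroup) : star (s * t) = star t * star s := by
  cases s with
  | zero => exact (mul_zero' _).symm
  | triple α g β h =>
    cases t with
    | zero => rfl
    | triple γ k δ h₂ =>
      by_cases H₁ : ∃ ε : D.Path, ∃ h' : β.source = ε.range, γ = β.concat ε h'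
      · obtain ⟨ε, h', rfl⟩ := H₁
        rw [triple_mul_left]
        refine Eq.trans ?_ (triple_mul_right h' (inv_rel h₂) (inv_rel h)).symm
        exact triple_congr rfl (by simp) (by simp only [inv_inv])
      · by_cases H₂ : ∃ ε : D.Path, ∃ h' : γ.source = ε.range, β = γ.concat ε h'
        · obtain ⟨ε, h', rfl⟩ := H₂
          rw [triple_mul_right]
          refine Eq.trans ?_ (triple_mul_left (inv_rel h₂) h' (inv_rel h)).symm
          exact triple_congr rfl (by simp) rfl
        · rw [triple_mul_eq_zero _ _ H₁ H₂]
          exact (triple_mul_eq_zero _ _ H₂ H₁).symm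

theorem rel_mul_aux {α β γ δ : D.Path} {g k : G} (h : α.source = g • β.source)
    (h₂ : γ.source = k • δ.source)
    (H : ∃ ε : D.Path, ∃ h' : β.source = ε.range, γ = β.concat ε h') (z x : D.Path × G) :
    Rel (triple α g β h * triple γ k δ h₂) z x ↔
      ∃ y, Rel (triple α g β h) z y ∧ Rel (triple γ k δ h₂) y x := by
  obtain ⟨ε, h', rfl⟩ := H
  rw [triple_mul_left]
  constructor
  · rintro ⟨η, hη, e₁, e₂, e₃⟩
    have hs : ε.source = (η.smul k).range := by
      rw [← Path.source_concat β ε h', h₂, hη]; rfl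
    refine ⟨((β.concat ε h').concat (η.smul k) (mul_aux h₂ hη), η.cocycle k * x.2),
      ⟨ε.concat (η.smul k) hs, h', ?_, ?_, ?_⟩, ⟨η, hη, e₁, rfl, rfl⟩⟩
    · exact Path.ext rfl (List.append_assoc _ _ _)
    · rw [e₂]
      refine Path.ext rfl ?_
      simp only [Path.concat, Path.smul, Path.cocycle, listSMul_append, listSMul_mul,
        List.append_assoc]
    · rw [e₃, Path.cocycle_concat, Path.cocycle_mul, mul_assoc]
  · rintro ⟨y, ⟨ζ, hζ, e₁, e₂, e₃⟩, ⟨η, hη, e₁', e₂', e₃'⟩⟩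
    have hs : ε.source = (η.smul k).range := by
      rw [← Path.source_concat β ε h', h₂, hη]; rfl
    have : ζ = ε.concat (η.smul k) hs := by
      refine Path.concat_left_cancel (h := hζ) (h' := h') (e₁.symm.trans (e₂'.trans ?_))
      exact Path.ext rfl (List.append_assoc _ _ _)
    subst this
    refine ⟨η, hη, e₁', ?_, ?_⟩
    · rw [e₂]
      refine Path.ext rfl ?_
      simp only [Path.concat, Path.smul, Path.cocycle, listSMul_append, listSMul_mul,
        List.append_assoc]
    · rw [e₃, e₃', Path.cocycle_concat, Path.cocycle_mul, mul_assoc]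

theorem rel_mul (s t : D.InvSemigroup) (z x : D.Path × G) :
    Rel (s * t) z x ↔ ∃ y, Rel s z y ∧ Rel t y x := by
  cases s with
  | zero => exact ⟨False.elim, fun ⟨_, h, _⟩ => h⟩
  | triple α g β h =>
    cases t with
    | zero => exact ⟨False.elim, fun ⟨_, _, h⟩ => h⟩
    | triple γ k δ h₂ =>
      by_cases H₁ : ∃ ε : D.Path, ∃ h' : β.source = ε.range, γ = β.concat ε h'
      · exact rel_mul_aux h h₂ H₁ z x
      · by_cases H₂ : ∃ ε : D.Path, ∃ h' : γ.source = ε.range, β = γ.concat ε h'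
        · rw [← rel_star, star_mul']
          refine (rel_mul_aux (inv_rel h₂) (inv_rel h) H₂ x z).trans ?_
          refine exists_congr fun y => ?_
          rw [and_comm]
          exact and_congr (rel_star (triple α g β h) _ _) (rel_star (triple γ k δ h₂) _ _)
        · rw [triple_mul_eq_zero _ _ H₁ H₂]
          refine ⟨False.elim, ?_⟩
          rintro ⟨y, ⟨ε, h', e₁, -, -⟩, ⟨η, hη, -, e₂, -⟩⟩
          have e := e₁.symm.trans e₂
          have er : (β.concat ε h').range = (γ.concat (η.smul k) (mul_aux h₂ hη)).range :=
            congrArg Path.range e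
          replace er : β.range = γ.range := er
          have el : β.edges ++ ε.edges = γ.edges ++ (η.smul k).edges := congrArg Path.edges e
          have aux : ∀ (μ ν : D.Path) (l : List W), μ.range = ν.range → ν.edges = μ.edges ++ l →
              ∃ ε : D.Path, ∃ h' : μ.source = ε.range, ν = μ.concat ε h' := by
            intro μ ν l hr hl
            have hp : ∀ (l₁ : List W) (x : V), D.IsPath x (l₁ ++ l) →
                D.IsPath (D.listSource x l₁) l := by
              intro l₁
              induction l₁ with
              | nil => intro x h; exact h
              | cons e l₁ ih => intro x h; exact ih _ h.2
            have hν := ν.isPath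
            rw [hl, ← hr] at hν
            exact ⟨⟨μ.source, l, hp _ _ hν⟩, rfl, Path.ext hr.symm hl⟩
          rcases List.append_eq_append_iff.1 el with ⟨l, hl, -⟩ | ⟨l, hl, -⟩
          · exact H₁ (aux β γ l er hl)
          · exact H₂ (aux γ β l er.symm hl)

theorem mul_assoc' (s t u : D.InvSemigroup) : s * t * u = s * (t * u) := by
  apply rel_inj
  intro y x
  simp only [rel_mul]
  constructor
  · rintro ⟨z, ⟨w, h₁, h₂⟩, h₃⟩
    exact ⟨w, h₁, z, h₂, h₃⟩
  · rintro ⟨w, h₁, z, h₂, h₃⟩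
    exact ⟨z, ⟨w, h₁, h₂⟩, h₃⟩

theorem mul_star_mul' (s : D.InvSemigroup) : s * star s * s = s := by
  cases s with
  | zero => rfl
  | triple α g β h =>
    refine (congrArg (· * _) (triple_mul_self h (inv_rel h))).trans ?_
    refine (triple_mul_self _ h).trans ?_
    exact triple_congr rfl (by simp) rfl

/-- An idempotent acts as a partial identity. -/
theorem rel_idem {e : D.InvSemigroup} (he : IsIdempotentElem e) {y x : D.Path × G}
    (h : Rel e y x) : y = x := by
  rw [← he.eq, rel_mul] at h
  obtain ⟨z, h₁, h₂⟩ := h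
  have h₃ : Rel e y x := by rw [← he.eq, rel_mul]; exact ⟨z, h₁, h₂⟩
  obtain rfl := rel_functional h₂ h₃
  exact rel_functional ((rel_star e _ _).2 h₁) ((rel_star e _ _).2 h₃)

theorem idem_comm' (e f : D.InvSemigroup) (he : IsIdempotentElem e) (hf : IsIdempotentElem f) :
    e * f = f * e := by
  apply rel_inj
  intro y x
  simp only [rel_mul]
  constructor
  · rintro ⟨z, h₁, h₂⟩
    obtain rfl := rel_idem he h₁
    obtain rfl := rel_idem hf h₂
    exact ⟨_, h₂, h₁⟩
  · rintro ⟨z, h₁, h₂⟩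
    obtain rfl := rel_idem hf h₁
    obtain rfl := rel_idem he h₂
    exact ⟨_, h₂, h₁⟩

noncomputable instance : InverseSemigroupWithZero D.InvSemigroup where
  mul_assoc := mul_assoc'
  zero_mul := zero_mul'
  mul_zero := mul_zero'
  mul_star_mul := mul_star_mul'
  star_mul_star s := by
    have := mul_star_mul' (star s)
    rwa [star_star'] at this
  idem_comm := idem_comm'

end InvSemigroup
end SelfSimilarGraph

/-! ## Completing a *-algebra with a C*-seminorm -/

/-- A unital *-algebra over `ℂ` with a submultiplicative seminorm satisfying the C*-identity. -/
class PreCStarAlgebra (F : Type*) extends SeminormedRing F, StarRing F, NormedAlgebra ℂ F,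
    StarModule ℂ F where
  norm_star_mul_self : ∀ a : F, ‖star a * a‖ = ‖a‖ * ‖a‖

namespace PreCStarAlgebra

open UniformSpace

variable {F : Type*} [PreCStarAlgebra F]

theorem norm_star (a : F) : ‖star a‖ = ‖a‖ := by
  have key : ∀ a : F, ‖a‖ ≤ ‖star a‖ := by
    intro a
    rcases (norm_nonneg a).eq_or_lt with h | h
    · rw [← h]; exact norm_nonneg _
    · refine le_of_mul_le_mul_right ?_ h
      rw [← norm_star_mul_self]
      exact norm_mul_le _ _
  refine le_antisymm ?_ (key a)
  have := key (star a)
  rwa [star_star] at this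

theorem uniformContinuous_star : UniformContinuous (star : F → F) :=
  AddMonoidHomClass.uniformContinuous_of_bound (starAddEquiv : F ≃+ F) 1
    (fun a => by rw [one_mul]; exact (norm_star a).le)

/-- The adjoint on the completion extends the adjoint by continuity. -/
noncomputable instance : Star (Completion F) := ⟨Completion.map star⟩

instance : ContinuousStar (Completion F) := ⟨Completion.continuous_map⟩

theorem coe_star (a : F) : star (a : Completion F) = ((star a : F) : Completion F) :=
  Completion.map_coe uniformContinuous_star a

noncomputable instance : StarRing (Completion F) where
  star_involutive x := by
    induction x using Completion.induction_on with
    | hp => exact isClosed_eq (by fun_prop) (by fun_prop)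
    | ih a => rw [coe_star, coe_star, star_star]
  star_mul x y := by
    induction x, y using Completion.induction_on₂ with
    | hp => exact isClosed_eq (by fun_prop) (by fun_prop)
    | ih a b =>
      rw [← Completion.coe_mul, coe_star, coe_star, coe_star, star_mul, Completion.coe_mul]
  star_add x y := by
    induction x, y using Completion.induction_on₂ with
    | hp => exact isClosed_eq (by fun_prop) (by fun_prop)
    | ih a b =>
      rw [← Completion.coe_add, coe_star, coe_star, coe_star, star_add, Completion.coe_add]

noncomputable instance : NormedAlgebra ℂ (Completion F) where
  norm_smul_le := norm_smul_le

instance : StarModule ℂ (Completion F) where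
  star_smul c x := by
    induction x using Completion.induction_on with
    | hp =>
      exact isClosed_eq (continuous_star.comp (continuous_const_smul c))
        (continuous_star.const_smul (star c))
    | ih a =>
      rw [← Completion.coe_smul, coe_star, coe_star, star_smul, Completion.coe_smul]

instance : CStarRing (Completion F) where
  norm_mul_self_le x := by
    induction x using Completion.induction_on with
    | hp => exact isClosed_le (by fun_prop) (by fun_prop)
    | ih a =>
      rw [coe_star, ← Completion.coe_mul, Completion.norm_coe, Completion.norm_coe,
        norm_star_mul_self]

/-- The (separated) completion of a *-algebra with a C*-seminorm is a C*-algebra. -/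
noncomputable instance : CStarAlgebra (Completion F) where

end PreCStarAlgebra

/-! ## The free unital *-algebra -/

/-- The free unital *-algebra over `ℂ` on a set `X`: noncommutative polynomials in the letters
`x = inl x` and `x* = inr x`. -/
def FreeStarAlgebra (X : Type*) : Type _ := FreeAlgebra ℂ (X ⊕ X)

namespace FreeStarAlgebra

variable {X : Type*}

noncomputable instance : Ring (FreeStarAlgebra X) := inferInstanceAs (Ring (FreeAlgebra ℂ (X ⊕ X)))

noncomputable instance : Algebra ℂ (FreeStarAlgebra X) :=
  inferInstanceAs (Algebra ℂ (FreeAlgebra ℂ (X ⊕ X)))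

/-- The letter `x`. -/
noncomputable def of (x : X) : FreeStarAlgebra X := FreeAlgebra.ι ℂ (Sum.inl x)

/-- The letter `x*`. -/
noncomputable def ofStar (x : X) : FreeStarAlgebra X := FreeAlgebra.ι ℂ (Sum.inr x)

theorem induction {P : FreeStarAlgebra X → Prop} (algebraMap : ∀ c : ℂ, P (algebraMap ℂ _ c))
    (of : ∀ x, P (of x)) (ofStar : ∀ x, P (ofStar x))
    (mul : ∀ a b, P a → P b → P (a * b)) (add : ∀ a b, P a → P b → P (a + b))
    (a : FreeStarAlgebra X) : P a :=
  FreeAlgebra.induction ℂ (X ⊕ X) algebraMap (fun y => y.rec of ofStar) mul add a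

/-- The conjugate-linear anti-multiplicative map exchanging `x` and `x*`. -/
noncomputable def starHom : FreeStarAlgebra X →+* (FreeStarAlgebra X)ᵐᵒᵖ :=
  letI : Algebra ℂ (FreeStarAlgebra X)ᵐᵒᵖ := Algebra.compHom _ (starRingEnd ℂ)
  (FreeAlgebra.lift ℂ fun y : X ⊕ X => y.elim (fun x => MulOpposite.op (ofStar x))
    (fun x => MulOpposite.op (of x)) : FreeAlgebra ℂ (X ⊕ X) →ₐ[ℂ] (FreeStarAlgebra X)ᵐᵒᵖ).toRingHom

theorem starHom_of (x : X) : starHom (of x) = MulOpposite.op (ofStar x) :=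
  letI : Algebra ℂ (FreeStarAlgebra X)ᵐᵒᵖ := Algebra.compHom _ (starRingEnd ℂ)
  FreeAlgebra.lift_ι_apply _ _

theorem starHom_ofStar (x : X) : starHom (ofStar x) = MulOpposite.op (of x) :=
  letI : Algebra ℂ (FreeStarAlgebra X)ᵐᵒᵖ := Algebra.compHom _ (starRingEnd ℂ)
  FreeAlgebra.lift_ι_apply _ _

theorem starHom_algebraMap (c : ℂ) : starHom (algebraMap ℂ (FreeStarAlgebra X) c) =
    MulOpposite.op (algebraMap ℂ _ (starRingEnd ℂ c)) :=
  letI : Algebra ℂ (FreeStarAlgebra X)ᵐᵒᵖ := Algebra.compHom _ (starRingEnd ℂ)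
  AlgHom.commutes (FreeAlgebra.lift ℂ fun y : X ⊕ X => y.elim (fun x => MulOpposite.op (ofStar x))
    (fun x => MulOpposite.op (of x)) : FreeAlgebra ℂ (X ⊕ X) →ₐ[ℂ] (FreeStarAlgebra X)ᵐᵒᵖ) c

noncomputable instance : StarRing (FreeStarAlgebra X) where
  star a := (starHom a).unop
  star_involutive a := by
    change (starHom (starHom a).unop).unop = a
    induction a using FreeStarAlgebra.induction with
    | algebraMap c => simp [starHom_algebraMap]
    | of x => simp [starHom_of, starHom_ofStar]
    | ofStar x => simp [starHom_of, starHom_ofStar]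
    | mul a b ha hb => simp [ha, hb]
    | add a b ha hb => simp [ha, hb]
  star_mul a b := by simp
  star_add a b := by simp

theorem star_of (x : X) : star (of x) = ofStar x := congrArg MulOpposite.unop (starHom_of x)

theorem star_algebraMap (c : ℂ) : star (algebraMap ℂ (FreeStarAlgebra X) c) =
    algebraMap ℂ _ (star c) := congrArg MulOpposite.unop (starHom_algebraMap c)

instance : StarModule ℂ (FreeStarAlgebra X) where
  star_smul c a := by
    rw [Algebra.smul_def, star_mul, star_algebraMap, ← Algebra.commutes, ← Algebra.smul_def]

end FreeStarAlgebra

/-! ## The universal unital C*-algebra of a self-similar graph -/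

namespace SelfSimilarGraph

/-- The generators `p_x`, `s_e`, `u_g`. -/
inductive Gen (G V W : Type*) : Type _
  | p (x : V) : Gen G V W
  | s (e : W) : Gen G V W
  | u (g : G) : Gen G V W

section Relations

variable {G V W : Type*}

/-- The letter `p_x`. -/
noncomputable def pF (G W : Type*) (x : V) : FreeStarAlgebra (Gen G V W) := .of (.p x)

/-- The letter `s_e`. -/
noncomputable def sF (G V : Type*) (e : W) : FreeStarAlgebra (Gen G V W) := .of (.s e)

/-- The letter `u_g`. -/
noncomputable def uF (V W : Type*) (g : G) : FreeStarAlgebra (Gen G V W) := .of (.u g)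

end Relations

variable {G V W : Type*} [Group G] [MulAction G V] [MulAction G W] [Fintype V] [Fintype W]
  (D : SelfSimilarGraph G V W)

open Classical in
/-- The defining relations: the `p_x` are mutually orthogonal projections of sum `1` and the
`s_e` are partial isometries, they form a Cuntz-Krieger family, `u` is a unitary representation,
`u_g s_e = s_{ge} u_{φ(g,e)}` and `u_g p_x = p_{gx} u_g`. -/
inductive Relator : FreeStarAlgebra (Gen G V W) → FreeStarAlgebra (Gen G V W) → Prop
  | p_star (x : V) : Relator (star (pF G W x)) (pF G W x)
  | p_mul_self (x : V) : Relator (pF G W x * pF G W x) (pF G W x)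
  | p_mul (x y : V) : x ≠ y → Relator (pF G W x * pF G W y) 0
  | sum_p : Relator (∑ x : V, pF G W x) 1
  | s_mul_star_mul (e : W) : Relator (sF G V e * star (sF G V e) * sF G V e) (sF G V e)
  | star_s_mul (e : W) : Relator (star (sF G V e) * sF G V e) (pF G W (D.d e))
  | sum_s (x : V) : Relator (∑ e : W with D.r e = x, sF G V e * star (sF G V e)) (pF G W x)
  | u_one : Relator (uF V W 1) 1
  | u_mul (g h : G) : Relator (uF V W (g * h)) (uF V W g * uF V W h)
  | star_u_mul (g : G) : Relator (star (uF V W g) * uF V W g) 1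
  | u_mul_star (g : G) : Relator (uF V W g * star (uF V W g)) 1
  | u_s (g : G) (e : W) : Relator (uF V W g * sF G V e) (sF G V (g • e) * uF V W (D.φ g e))
  | u_p (g : G) (x : V) : Relator (uF V W g * pF G W x) (pF G W (g • x) * uF V W g)

/-- The C*-seminorms on the free unital *-algebra on the generators for which the defining
relations hold in the corresponding completion. -/
structure AdmissibleSeminorm extends Seminorm ℂ (FreeStarAlgebra (Gen G V W)) where
  mul_le : ∀ a b, toSeminorm (a * b) ≤ toSeminorm a * toSeminorm b
  star_mul_self : ∀ a, toSeminorm (star a * a) = toSeminorm a * toSeminorm a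
  relator : ∀ a b, D.Relator a b → toSeminorm (a - b) = 0

namespace AdmissibleSeminorm

variable {D}

instance : Nonempty D.AdmissibleSeminorm :=
  ⟨{ toSeminorm := 0
     mul_le := fun _ _ => by simp
     star_mul_self := fun _ => by simp
     relator := fun _ _ _ => rfl }⟩

variable (q : D.AdmissibleSeminorm)

theorem congr {a b : FreeStarAlgebra (Gen G V W)} (h : D.Relator a b) :
    q.toSeminorm a = q.toSeminorm b := by
  have h₁ := abs_sub_map_le_sub q.toSeminorm a b
  rw [q.relator a b h] at h₁
  exact sub_eq_zero.1 (abs_nonpos_iff.1 h₁)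

theorem le_star (a : FreeStarAlgebra (Gen G V W)) : q.toSeminorm a ≤ q.toSeminorm (star a) := by
  rcases (apply_nonneg q.toSeminorm a).eq_or_lt with h | h
  · rw [← h]; exact apply_nonneg _ _
  · refine le_of_mul_le_mul_right ?_ h
    rw [← q.star_mul_self]
    exact q.mul_le _ _

theorem star_le (a : FreeStarAlgebra (Gen G V W)) : q.toSeminorm (star a) ≤ q.toSeminorm a := by
  have := q.le_star (star a)
  rwa [star_star] at this

theorem le_one_of_sq {x y : ℝ} (hy : y ≤ 1) (h : y = x * x) : x ≤ 1 := by nlinarith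

theorem one_le : q.toSeminorm 1 ≤ 1 := by
  have := q.star_mul_self 1
  rw [star_one, one_mul] at this
  nlinarith [apply_nonneg q.toSeminorm 1]

theorem p_le (x : V) : q.toSeminorm (pF G W x) ≤ 1 := by
  have h₁ := q.star_mul_self (pF G W x)
  have h₂ := q.congr (.p_mul_self x)
  have h₃ := q.mul_le (star (pF G W x) - pF G W x) (pF G W x)
  have h₄ := abs_sub_map_le_sub q.toSeminorm (star (pF G W x) * pF G W x) (pF G W x * pF G W x)
  rw [q.relator _ _ (.p_star x), zero_mul] at h₃
  rw [← sub_mul] at h₄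
  have h₅ := sub_eq_zero.1 (abs_nonpos_iff.1 (h₄.trans h₃))
  rw [h₂, h₁] at h₅
  nlinarith

theorem gen_le (y : Gen G V W) : q.toSeminorm (.of y) ≤ 1 := by
  cases y with
  | p x => exact q.p_le x
  | s e =>
    refine le_one_of_sq ?_ (q.star_mul_self (sF G V e))
    rw [q.congr (.star_s_mul e)]
    exact q.p_le _
  | u g =>
    refine le_one_of_sq ?_ (q.star_mul_self (uF V W g))
    rw [q.congr (.star_u_mul g)]
    exact q.one_le

theorem bounded (a : FreeStarAlgebra (Gen G V W)) :
    ∃ C : ℝ, ∀ q : D.AdmissibleSeminorm, q.toSeminorm a ≤ C := by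
  induction a using FreeStarAlgebra.induction with
  | algebraMap c =>
    refine ⟨‖c‖, fun q => ?_⟩
    rw [Algebra.algebraMap_eq_smul_one, map_smul_eq_mul]
    exact mul_le_of_le_one_right (norm_nonneg c) q.one_le
  | of y => exact ⟨1, fun q => q.gen_le y⟩
  | ofStar y =>
    refine ⟨1, fun q => ?_⟩
    rw [← FreeStarAlgebra.star_of]
    exact (q.star_le _).trans (q.gen_le y)
  | mul a b ha hb =>
    obtain ⟨C, hC⟩ := ha
    obtain ⟨C', hC'⟩ := hb
    refine ⟨C * C', fun q => (q.mul_le a b).trans ?_⟩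
    exact mul_le_mul (hC q) (hC' q) (apply_nonneg _ _) ((apply_nonneg q.toSeminorm a).trans (hC q))
  | add a b ha hb =>
    obtain ⟨C, hC⟩ := ha
    obtain ⟨C', hC'⟩ := hb
    exact ⟨C + C', fun q => (map_add_le_add q.toSeminorm a b).trans (add_le_add (hC q) (hC' q))⟩

theorem bddAbove (a : FreeStarAlgebra (Gen G V W)) :
    BddAbove (Set.range fun q : D.AdmissibleSeminorm => q.toSeminorm a) := by
  obtain ⟨C, hC⟩ := bounded (D := D) a
  exact ⟨C, by rintro _ ⟨q, rfl⟩; exact hC q⟩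

end AdmissibleSeminorm

/-- The universal C*-seminorm: the supremum of all admissible C*-seminorms. -/
noncomputable def maxNorm (a : FreeStarAlgebra (Gen G V W)) : ℝ :=
  ⨆ q : D.AdmissibleSeminorm, q.toSeminorm a

theorem le_maxNorm (q : D.AdmissibleSeminorm) (a : FreeStarAlgebra (Gen G V W)) :
    q.toSeminorm a ≤ D.maxNorm a := le_ciSup (AdmissibleSeminorm.bddAbove a) q

theorem maxNorm_nonneg (a : FreeStarAlgebra (Gen G V W)) : 0 ≤ D.maxNorm a :=
  Real.iSup_nonneg fun q => apply_nonneg q.toSeminorm a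

theorem maxNorm_zero : D.maxNorm 0 = 0 := by simp [maxNorm]

theorem maxNorm_neg (a : FreeStarAlgebra (Gen G V W)) : D.maxNorm (-a) = D.maxNorm a := by
  simp only [maxNorm, map_neg_eq_map]

theorem maxNorm_add_le (a b : FreeStarAlgebra (Gen G V W)) :
    D.maxNorm (a + b) ≤ D.maxNorm a + D.maxNorm b :=
  ciSup_le fun q => (map_add_le_add q.toSeminorm a b).trans
    (add_le_add (D.le_maxNorm q a) (D.le_maxNorm q b))

theorem maxNorm_smul_le (c : ℂ) (a : FreeStarAlgebra (Gen G V W)) :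
    D.maxNorm (c • a) ≤ ‖c‖ * D.maxNorm a :=
  ciSup_le fun q => by
    rw [map_smul_eq_mul]
    exact mul_le_mul_of_nonneg_left (D.le_maxNorm q a) (norm_nonneg c)

theorem maxNorm_mul_le (a b : FreeStarAlgebra (Gen G V W)) :
    D.maxNorm (a * b) ≤ D.maxNorm a * D.maxNorm b :=
  ciSup_le fun q => (q.mul_le a b).trans
    (mul_le_mul (D.le_maxNorm q a) (D.le_maxNorm q b) (apply_nonneg _ _) (D.maxNorm_nonneg a))

theorem maxNorm_star_mul_self (a : FreeStarAlgebra (Gen G V W)) :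
    D.maxNorm (star a * a) = D.maxNorm a * D.maxNorm a := by
  apply le_antisymm
  · refine ciSup_le fun q => ?_
    rw [q.star_mul_self]
    exact mul_le_mul (D.le_maxNorm q a) (D.le_maxNorm q a) (apply_nonneg _ _) (D.maxNorm_nonneg a)
  · have h : D.maxNorm a ≤ √(D.maxNorm (star a * a)) := ciSup_le fun q => by
      apply Real.le_sqrt_of_sq_le
      rw [sq, ← q.star_mul_self]
      exact D.le_maxNorm q _
    calc D.maxNorm a * D.maxNorm a
        ≤ √(D.maxNorm (star a * a)) * √(D.maxNorm (star a * a)) :=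
          mul_le_mul h h (D.maxNorm_nonneg a) (Real.sqrt_nonneg _)
      _ = D.maxNorm (star a * a) := Real.mul_self_sqrt (D.maxNorm_nonneg _)

/-- The free unital *-algebra on the generators, with the universal C*-seminorm. -/
def PreO (_ : SelfSimilarGraph G V W) : Type _ := FreeStarAlgebra (Gen G V W)

namespace PreO

noncomputable instance : Ring D.PreO := inferInstanceAs (Ring (FreeStarAlgebra (Gen G V W)))

noncomputable instance : StarRing D.PreO :=
  inferInstanceAs (StarRing (FreeStarAlgebra (Gen G V W)))

noncomputable instance : Algebra ℂ D.PreO :=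
  inferInstanceAs (Algebra ℂ (FreeStarAlgebra (Gen G V W)))

instance : StarModule ℂ D.PreO := inferInstanceAs (StarModule ℂ (FreeStarAlgebra (Gen G V W)))

noncomputable instance : SeminormedAddCommGroup D.PreO :=
  AddGroupSeminorm.toSeminormedAddCommGroup
    { toFun := D.maxNorm
      map_zero' := D.maxNorm_zero
      add_le' := D.maxNorm_add_le
      neg' := D.maxNorm_neg }

noncomputable instance : PreCStarAlgebra D.PreO where
  dist_eq := fun _ _ => rfl
  norm_mul_le := D.maxNorm_mul_le
  norm_smul_le := D.maxNorm_smul_le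
  norm_star_mul_self := D.maxNorm_star_mul_self

end PreO

/-- The universal unital C*-algebra generated by the `p_x`, `s_e` and `u_g` subject to the
defining relations. -/
abbrev O : Type _ := UniformSpace.Completion D.PreO

/-- The canonical map from noncommutative *-polynomials in the generators. -/
noncomputable def toO (a : FreeStarAlgebra (Gen G V W)) : D.O :=
  UniformSpace.Completion.coe' (show D.PreO from a)

/-- The projection `p_x`. -/
noncomputable def p (x : V) : D.O := D.toO (pF G W x)

/-- The partial isometry `s_e`. -/
noncomputable def s (e : W) : D.O := D.toO (sF G V e)

/-- The unitary `u_g`. -/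
noncomputable def u (g : G) : D.O := D.toO (uF V W g)

/-- `s_α` for the path `α` with range `x` and given edges: it is `p_x` for the path of length
zero, `s_e` for an edge, and `s_e s_{α'}` for a path `e α'` of length at least two. -/
noncomputable def sList (D : SelfSimilarGraph G V W) : V → List W → D.O
  | x, [] => D.p x
  | _, [e] => D.s e
  | _, e :: f :: l => D.s e * sList D (D.d e) (f :: l)

/-- The element `s_α` of the algebra. -/
noncomputable def sPath (α : D.Path) : D.O := sList D α.range α.edges

/-- The map `π(α, g, β) = s_α u_g s_β*`, `π(0) = 0`. -/
noncomputable def π : D.InvSemigroup → D.O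
  | .zero => 0
  | .triple α g β _ => D.sPath α * D.u g * star (D.sPath β)

end SelfSimilarGraph

/-! Multiplicativity of `π` rests on a fact that is not among the defining relations: distinct edges
have orthogonal range projections, because the `s_e s_e*` are projections with sum `1`. Hence `s_β*
s_γ` equals `s_ε` if `γ = βε`, `s_ε*` if `β = γε`, and `0` otherwise. Together with `u_g s_ε =
s_{gε} u_{φ(g,ε)}` this reproduces the product of the inverse semigroup (`π_mul`).

For tightness, note that the nonzero idempotents are the `(α, 1, α)`, sent by `π` to `s_α s_α*`. By
the Cuntz-Krieger relation this projection is the sum of the `s_{αe} s_{αe}*` over the edges `e`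
with range `d(α)`, so for each `n` the projections of the paths of length `n` have supremum `1`. If
`n` bounds the lengths of all paths occurring in `X`, `Y`, `Z`, then a path of length `n` lies below
or is orthogonal to each idempotent in these sets. The tightness inequality can be checked below one
such path at a time, where it reduces to the definition of a cover (`isTightMap_of_refinement`).

Conversely, two kinds of covers suffice for universality: the vertices cover the whole semilattice,
and the edges with range `x` cover what lies below `(x, 1, x)`, since there are no sources. A tight
`ρ` therefore turns them into sums, and the elements `ρ(x, 1, x)`, `ρ(e, 1, d(e))` and `∑ x, ρ(gx,
g, x)` satisfy the relations of `p_x`, `s_e` and `u_g` (`lift_genValue_relator`). The resulting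
homomorphism `ψ` satisfies `ψ ∘ π = ρ` because `(α, g, β) = (α, 1, d(α)) (d(α), g, d(β)) (β, 1,
d(β))*`. It is unique because every generator is a value of `π` or a finite sum of such values. -/

theorem CStarAlgebra.mul_eq_zero_of_sum_eq_one {A ι : Type*} [CStarAlgebra A] {s : Finset ι}
    {q : ι → A} (hs : ∀ i ∈ s, star (q i) = q i) (hq : ∀ i ∈ s, q i * q i = q i)
    (h1 : ∑ i ∈ s, q i = 1) {i j : ι} (hi : i ∈ s) (hj : j ∈ s) (hij : i ≠ j) :
    q i * q j = 0 := by
  classical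
  let _ := CStarAlgebra.spectralOrder A
  let _ := CStarAlgebra.spectralOrderedRing A
  have key : ∀ k ∈ s, q j * q k * q j = star (q k * q j) * (q k * q j) := fun k hk => by
    rw [star_mul, hs k hk, hs j hj, mul_assoc, mul_assoc, ← mul_assoc (q k) (q k), hq k hk]
  -- Compressing `∑ q_k = 1` by `q_j` leaves a vanishing sum of the positive elements `(q_k q_j)*
  -- (q_k q_j)`, so each of them is zero.
  have hsum : ∑ k ∈ s.erase j, q j * q k * q j = 0 := by
    have h := congrArg (fun a => q j * a * q j) h1
    simp only [Finset.mul_sum, Finset.sum_mul, mul_one] at h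
    rw [← Finset.add_sum_erase s _ hj, hq j hj] at h
    simpa [hq j hj] using h
  rw [Finset.sum_eq_zero_iff_of_nonneg fun k hk => by
    rw [key k (Finset.mem_of_mem_erase hk)]; exact star_mul_self_nonneg _] at hsum
  have h := hsum i (Finset.mem_erase.2 ⟨hij, hi⟩)
  rwa [key i hi, CStarRing.star_mul_self_eq_zero_iff] at h

/-! ### Relations in the universal algebra and multiplicativity of `π` -/

namespace SelfSimilarGraph

section Algebra

variable {G V W : Type*} [Group G] [MulAction G V] [MulAction G W] [Fintype V] [Fintype W]
  (D : SelfSimilarGraph G V W)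

/-- The canonical map to the universal C*-algebra as a *-homomorphism. -/
noncomputable def toOHom : FreeStarAlgebra (Gen G V W) →⋆ₐ[ℂ] D.O where
  toFun := D.toO
  map_one' := rfl
  map_mul' a b := UniformSpace.Completion.coe_mul (α := D.PreO) a b
  map_zero' := rfl
  map_add' a b := UniformSpace.Completion.coe_add (α := D.PreO) a b
  commutes' _ := rfl
  map_star' a := (PreCStarAlgebra.coe_star (F := D.PreO) a).symm

@[simp] theorem toOHom_pF (x : V) : D.toOHom (pF G W x) = D.p x := rfl
@[simp] theorem toOHom_sF (e : W) : D.toOHom (sF G V e) = D.s e := rfl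
@[simp] theorem toOHom_uF (g : G) : D.toOHom (uF V W g) = D.u g := rfl

@[simp] theorem toOHom_star (a : FreeStarAlgebra (Gen G V W)) :
    D.toOHom (star a) = star (D.toOHom a) := map_star D.toOHom a

theorem denseRange_toOHom : DenseRange D.toOHom :=
  UniformSpace.Completion.denseRange_coe (α := D.PreO)

theorem norm_toOHom (a : FreeStarAlgebra (Gen G V W)) : ‖D.toOHom a‖ = D.maxNorm a :=
  UniformSpace.Completion.norm_coe (E := D.PreO) a

variable {D}

/-- Every admissible seminorm vanishes on `a - b`, hence so does their supremum, which is the norm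
of the image. -/
theorem toOHom_eq {a b : FreeStarAlgebra (Gen G V W)} (h : D.Relator a b) :
    D.toOHom a = D.toOHom b := by
  rw [← sub_eq_zero, ← map_sub, ← norm_eq_zero, norm_toOHom]
  exact le_antisymm (ciSup_le fun q => (q.relator a b h).le) (D.maxNorm_nonneg _)

variable (D)

theorem star_p (x : V) : star (D.p x) = D.p x := by
  simpa using toOHom_eq (Relator.p_star (D := D) x)

theorem p_mul_self (x : V) : D.p x * D.p x = D.p x := by
  simpa using toOHom_eq (Relator.p_mul_self (D := D) x)

theorem p_mul_p {x y : V} (h : x ≠ y) : D.p x * D.p y = 0 := by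
  simpa using toOHom_eq (Relator.p_mul (D := D) x y h)

theorem sum_p : ∑ x, D.p x = 1 := by
  simpa using toOHom_eq (Relator.sum_p (D := D))

theorem s_mul_star_mul (e : W) : D.s e * star (D.s e) * D.s e = D.s e := by
  simpa using toOHom_eq (Relator.s_mul_star_mul (D := D) e)

theorem star_s_mul (e : W) : star (D.s e) * D.s e = D.p (D.d e) := by
  simpa using toOHom_eq (Relator.star_s_mul (D := D) e)

open Classical in
theorem sum_s (x : V) : ∑ e : W with D.r e = x, D.s e * star (D.s e) = D.p x := by
  simpa using toOHom_eq (Relator.sum_s (D := D) x)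

theorem u_one : D.u 1 = 1 := by
  simpa using toOHom_eq (Relator.u_one (D := D))

theorem u_mul (g h : G) : D.u (g * h) = D.u g * D.u h := by
  simpa using toOHom_eq (Relator.u_mul (D := D) g h)

theorem star_u_mul (g : G) : star (D.u g) * D.u g = 1 := by
  simpa using toOHom_eq (Relator.star_u_mul (D := D) g)

theorem u_mul_s (g : G) (e : W) : D.u g * D.s e = D.s (g • e) * D.u (D.φ g e) := by
  simpa using toOHom_eq (Relator.u_s (D := D) g e)

theorem u_mul_p (g : G) (x : V) : D.u g * D.p x = D.p (g • x) * D.u g := by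
  simpa using toOHom_eq (Relator.u_p (D := D) g x)

theorem star_u (g : G) : star (D.u g) = D.u g⁻¹ := by
  have h : D.u g * D.u g⁻¹ = 1 := by rw [← u_mul, mul_inv_cancel, u_one]
  exact left_inv_eq_right_inv (D.star_u_mul g) h

theorem s_mul_p (e : W) : D.s e * D.p (D.d e) = D.s e := by
  rw [← star_s_mul, ← mul_assoc, s_mul_star_mul]

theorem sum_s_mul_star : ∑ e, D.s e * star (D.s e) = 1 := by
  classical
  rw [← D.sum_p, ← Finset.sum_fiberwise Finset.univ D.r]
  exact Finset.sum_congr rfl fun x _ => D.sum_s x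

/-- The range projections of all edges sum to `1`, so those of `e` and `f` are orthogonal; this is
then inserted between `s_e*` and `s_f`. -/
theorem star_s_mul_s {e f : W} (h : e ≠ f) : star (D.s e) * D.s f = 0 := by
  have h₀ : D.s e * star (D.s e) * (D.s f * star (D.s f)) = 0 :=
    CStarAlgebra.mul_eq_zero_of_sum_eq_one (fun e _ => by rw [star_mul, star_star])
      (fun e _ => by rw [← mul_assoc, s_mul_star_mul]) D.sum_s_mul_star
      (Finset.mem_univ e) (Finset.mem_univ f) h
  have h₁ : star (D.s e) * D.s e * star (D.s e) = star (D.s e) := by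
    simpa [mul_assoc] using congrArg star (D.s_mul_star_mul e)
  calc star (D.s e) * D.s f
      = star (D.s e) * D.s e * star (D.s e) * (D.s f * star (D.s f) * D.s f) := by
        rw [h₁, s_mul_star_mul]
    _ = star (D.s e) * (D.s e * star (D.s e) * (D.s f * star (D.s f))) * D.s f := by
        simp only [mul_assoc]
    _ = 0 := by rw [h₀, mul_zero, zero_mul]

/-- In the Cuntz-Krieger sum for `p_{r(e)}` only the summand of `e` survives multiplication by
`s_e`. -/
theorem p_mul_s (e : W) : D.p (D.r e) * D.s e = D.s e := by
  classical
  rw [← sum_s, Finset.sum_mul, Finset.sum_eq_single e, s_mul_star_mul]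
  · intro f _ hf
    rw [mul_assoc, D.star_s_mul_s hf, mul_zero]
  · simp

/-- Since `s_e p_{d(e)} = s_e`, the separate clause for a single edge agrees with the general
recursion, and inductions need no special case. -/
theorem sList_cons (x : V) (e : W) (l : List W) :
    sList D x (e :: l) = D.s e * sList D (D.d e) l := by
  cases l with
  | nil => exact (D.s_mul_p e).symm
  | cons f l => rfl

variable {D}

theorem p_mul_sList {l : List W} {x : V} (h : D.IsPath x l) :
    D.p x * sList D x l = sList D x l := by
  cases l with
  | nil => exact D.p_mul_self x
  | cons e l => rw [sList_cons, ← mul_assoc, ← h.1, p_mul_s]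

theorem sList_append {l l' : List W} : ∀ {x : V}, D.IsPath (D.listSource x l) l' →
    sList D x (l ++ l') = sList D x l * sList D (D.listSource x l) l' := by
  induction l with
  | nil => intro x h; exact (p_mul_sList h).symm
  | cons e l ih =>
    intro x h
    rw [List.cons_append, sList_cons, sList_cons, ih h, mul_assoc]; rfl

theorem star_sList_mul_self {l : List W} : ∀ {x : V}, D.IsPath x l →
    star (sList D x l) * sList D x l = D.p (D.listSource x l) := by
  induction l with
  | nil => intro x _; exact (congrArg (· * _) (D.star_p x)).trans (D.p_mul_self x)
  | cons e l ih =>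
    intro x h
    rw [sList_cons, star_mul, mul_assoc, ← mul_assoc (star (D.s e)), star_s_mul,
      p_mul_sList h.2, ih h.2]; rfl

theorem u_mul_sList (l : List W) : ∀ (g : G) (x : V),
    D.u g * sList D x l = sList D (g • x) (D.listSMul g l) * D.u (D.listCocycle g l) := by
  induction l with
  | nil => intro g x; exact D.u_mul_p g x
  | cons e l ih =>
    intro g x
    have h : D.φ g e • D.d e = D.d (g • e) := by rw [D.φ_smul, D.d_smul]
    rw [sList_cons, ← mul_assoc, u_mul_s, mul_assoc, ih, ← mul_assoc, h]
    exact (congrArg (· * _) (sList_cons D (g • x) (g • e) (D.listSMul (D.φ g e) l)).symm)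

/-- Different ranges give `p_x p_y = 0`. Otherwise common first edges cancel until the lists differ.
The prefix condition is imposed only for equal ranges because edge lists alone do not distinguish
paths of length zero. -/
theorem star_sList_mul_eq_zero {l l' : List W} : ∀ {x y : V}, D.IsPath x l → D.IsPath y l' →
    (x = y → ¬ l <+: l' ∧ ¬ l' <+: l) → star (sList D x l) * sList D y l' = 0 := by
  have key : ∀ {l l' : List W} {x y : V}, D.IsPath x l → D.IsPath y l' → x ≠ y →
      star (sList D x l) * sList D y l' = 0 := fun {l l' x y} h h' hxy => by
    rw [← p_mul_sList h, ← p_mul_sList h', star_mul, star_p, mul_assoc, ← mul_assoc (D.p x),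
      D.p_mul_p hxy, zero_mul, mul_zero]
  induction l generalizing l' with
  | nil => intro x y h h' H; exact key h h' fun hxy => (H hxy).1 List.nil_prefix
  | cons e l ih =>
    intro x y h h' H
    rcases ne_or_eq x y with hxy | rfl
    · exact key h h' hxy
    cases l' with
    | nil => exact ((H rfl).2 List.nil_prefix).elim
    | cons f l' =>
      rw [sList_cons, sList_cons, star_mul, mul_assoc, ← mul_assoc (star (D.s e))]
      rcases ne_or_eq e f with hef | rfl
      · rw [D.star_s_mul_s hef, zero_mul, mul_zero]
      · rw [star_s_mul, p_mul_sList h'.2]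
        refine ih h.2 h'.2 fun _ => ⟨fun hp => (H rfl).1 ?_, fun hp => (H rfl).2 ?_⟩ <;>
          simpa using hp

theorem sPath_concat (α β : D.Path) (h : α.source = β.range) :
    D.sPath (α.concat β h) = D.sPath α * D.sPath β := by
  refine (sList_append (l := α.edges) (l' := β.edges) (x := α.range) ?_).trans ?_
  · have := β.isPath
    rwa [← h] at this
  · change _ * sList D α.source _ = _
    rw [h]; rfl

theorem p_mul_sPath (α : D.Path) : D.p α.range * D.sPath α = D.sPath α := p_mul_sList α.isPath

theorem star_sPath_mul_self (α : D.Path) : star (D.sPath α) * D.sPath α = D.p α.source :=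
  star_sList_mul_self α.isPath

theorem sPath_mul_p (α : D.Path) : D.sPath α * D.p α.source = D.sPath α := by
  refine (sPath_concat α (Path.vertex D α.source) rfl).symm.trans ?_
  rw [Path.concat_vertex]

theorem u_mul_sPath (g : G) (α : D.Path) :
    D.u g * D.sPath α = D.sPath (α.smul g) * D.u (α.cocycle g) := u_mul_sList _ _ _

theorem star_sPath_mul_concat (α β : D.Path) (h : α.source = β.range) :
    star (D.sPath α) * D.sPath (α.concat β h) = D.sPath β := by
  rw [sPath_concat, ← mul_assoc, star_sPath_mul_self, h, p_mul_sPath]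

omit [Fintype V] [Fintype W] in
theorem Path.exists_concat_of_prefix {α β : D.Path} (h : α.range = β.range)
    (hp : α.edges <+: β.edges) :
    ∃ ε : D.Path, ∃ h' : α.source = ε.range, β = α.concat ε h' := by
  obtain ⟨l, hl⟩ := hp
  have split : ∀ (l₁ : List W) (x : V), D.IsPath x (l₁ ++ l) →
      D.IsPath (D.listSource x l₁) l := by
    intro l₁
    induction l₁ with
    | nil => intro x h; exact h
    | cons e l₁ ih => intro x h; exact ih _ h.2
  have hβ := β.isPath
  rw [← hl, ← h] at hβ
  exact ⟨⟨α.source, l, split _ _ hβ⟩, rfl, Path.ext h.symm hl.symm⟩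

theorem star_sPath_mul_eq_zero {β γ : D.Path}
    (H₁ : ¬ ∃ ε : D.Path, ∃ h' : β.source = ε.range, γ = β.concat ε h')
    (H₂ : ¬ ∃ ε : D.Path, ∃ h' : γ.source = ε.range, β = γ.concat ε h') :
    star (D.sPath β) * D.sPath γ = 0 :=
  star_sList_mul_eq_zero β.isPath γ.isPath fun h =>
    ⟨fun hp => H₁ (Path.exists_concat_of_prefix h hp),
      fun hp => H₂ (Path.exists_concat_of_prefix h.symm hp)⟩

theorem π_triple (α : D.Path) (g : G) (β : D.Path) (h : α.source = g • β.source) :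
    D.π (.triple α g β h) = D.sPath α * D.u g * star (D.sPath β) := rfl

theorem π_star (s : D.InvSemigroup) : D.π (star s) = star (D.π s) := by
  cases s with
  | zero => exact (star_zero _).symm
  | triple α g β h =>
    change D.sPath β * D.u g⁻¹ * star (D.sPath α) = _
    rw [π_triple, star_mul, star_mul, star_star, star_u, mul_assoc]

/-- The middle factor `s_β* s_{βε}` collapses to `s_ε`, and `u_g` then moves past it, producing
`s_{gε} u_{φ(g,ε)}`. -/
theorem π_mul_of_prefix {α β δ ε : D.Path} {g k : G} (h : α.source = g • β.source)
    (h' : β.source = ε.range) (h₂ : (β.concat ε h').source = k • δ.source) :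
    D.π (.triple α g β h * .triple (β.concat ε h') k δ h₂) =
      D.π (.triple α g β h) * D.π (.triple (β.concat ε h') k δ h₂) := by
  rw [InvSemigroup.triple_mul_left]
  simp only [π_triple, sPath_concat α, u_mul]
  calc _ = D.sPath α * (D.sPath (ε.smul g) * D.u (ε.cocycle g)) * D.u k * star (D.sPath δ) := by
        simp only [mul_assoc]
    _ = D.sPath α * (D.u g * (star (D.sPath β) * D.sPath (β.concat ε h'))) * D.u k *
          star (D.sPath δ) := by rw [← u_mul_sPath, star_sPath_mul_concat]
    _ = _ := by simp only [mul_assoc]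

theorem π_mul (s t : D.InvSemigroup) : D.π (s * t) = D.π s * D.π t := by
  cases s with
  | zero => exact (zero_mul _).symm
  | triple α g β h =>
    cases t with
    | zero => exact (mul_zero _).symm
    | triple γ k δ h₂ =>
      by_cases H₁ : ∃ ε : D.Path, ∃ h' : β.source = ε.range, γ = β.concat ε h'
      · obtain ⟨ε, h', rfl⟩ := H₁
        exact π_mul_of_prefix h h' h₂
      · by_cases H₂ : ∃ ε : D.Path, ∃ h' : γ.source = ε.range, β = γ.concat ε h'
        · obtain ⟨ε, h', rfl⟩ := H₂
          -- The case `β = γε` is the adjoint of the previous one.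
          apply star_injective
          rw [star_mul, ← π_star, ← π_star, ← π_star, InvSemigroup.star_mul']
          exact π_mul_of_prefix (InvSemigroup.inv_rel h₂) h' (InvSemigroup.inv_rel h)
        · rw [InvSemigroup.triple_mul_eq_zero _ _ H₁ H₂, π_triple, π_triple]
          calc (0 : D.O) = D.sPath α * D.u g * (star (D.sPath β) * D.sPath γ) * D.u k *
                star (D.sPath δ) := by rw [star_sPath_mul_eq_zero H₁ H₂, mul_zero, zero_mul,
                  zero_mul]
            _ = _ := by simp only [mul_assoc]

theorem isRepresentation_π : IsRepresentation D.π := ⟨rfl, π_mul, π_star⟩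

end Algebra

end SelfSimilarGraph

/-! ### A criterion for tightness -/

section Tight

/-- As `T` has supremum `⊤`, the inequality may be tested on each `β t`. If `t` is orthogonal to
some `x ∈ X` or below some `y ∈ Y`, the left side meets `β t` in `⊥`. Otherwise `t` belongs to the
relative cut; if nonzero, it meets some `z ∈ Z` and hence lies below it. -/
theorem isTightMap_of_refinement {L B : Type*} [SemilatticeInf L] [OrderBot L] [BooleanAlgebra B]
    {β : L → B} (hinf : ∀ a b, β (a ⊓ b) = β a ⊓ β b) (hbot : β ⊥ = ⊥)
    (href : ∀ F : Finset L, ∃ T : Finset L, ⊤ ≤ T.sup β ∧ ∀ t ∈ T, ∀ e ∈ F, t ≤ e ∨ t ⊓ e = ⊥) :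
    IsTightMap β := by
  classical
  intro X Y Z hZ
  have hmono : Monotone β := fun a b hab => by
    rw [← inf_eq_left.2 hab, hinf]; exact inf_le_right
  obtain ⟨T, hT, h⟩ := href (X ∪ Y ∪ Z)
  set a := X.inf β ⊓ Y.inf fun y => (β y)ᶜ with ha
  have key : ∀ t ∈ T, a ⊓ β t ≤ Z.sup β := by
    intro t ht
    by_cases hX : ∃ x ∈ X, t ⊓ x = ⊥
    · obtain ⟨x, hx, htx⟩ := hX
      have h₁ : a ⊓ β t ≤ β t ⊓ β x :=
        le_inf inf_le_right ((inf_le_left.trans inf_le_left).trans (Finset.inf_le hx))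
      rw [← hinf, htx, hbot] at h₁
      exact h₁.trans bot_le
    by_cases hY : ∃ y ∈ Y, t ≤ y
    · obtain ⟨y, hy, hty⟩ := hY
      have h₁ : a ⊓ β t ≤ (β y)ᶜ ⊓ β y :=
        inf_le_inf (inf_le_right.trans (Finset.inf_le (f := fun y => (β y)ᶜ) hy)) (hmono hty)
      rw [compl_inf_self] at h₁
      exact h₁.trans bot_le
    by_cases ht0 : t = ⊥
    · rw [ht0, hbot, inf_bot_eq]; exact bot_le
    push Not at hX hY
    obtain ⟨z, hz, hzt⟩ := hZ.2 t
      ⟨fun x hx => (h t ht x (by simp [hx])).resolve_right (hX x hx),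
        fun y hy => (h t ht y (by simp [hy])).resolve_left (hY y hy)⟩ ht0
    have htz : t ≤ z := (h t ht z (by simp [Finset.mem_coe.1 hz])).resolve_right
      (by rwa [inf_comm])
    exact inf_le_right.trans ((hmono htz).trans (Finset.le_sup hz))
  calc a = a ⊓ T.sup β := (inf_eq_left.2 (le_top.trans hT)).symm
    _ ≤ Z.sup β := by rw [Finset.sup_inf_distrib_left]; exact Finset.sup_le key

end Tight

/-! ### Suprema of projections as sums -/

section Idempotents

variable {R ι : Type*} [CommRing R] {s : Finset ι} {b : ι → {a : R // IsIdempotentElem a}}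

/-- Multiplication by the supremum fixes each summand, hence the sum; orthogonality plays no role.
-/
theorem IsIdempotentElem.le_sup_of_eq_sum {a : {a : R // IsIdempotentElem a}}
    (h : a.1 = ∑ i ∈ s, (b i).1) : a ≤ s.sup b := by
  change a.1 * (s.sup b).1 = a.1
  rw [h, Finset.sum_mul]
  exact Finset.sum_congr rfl fun i hi => (Finset.le_sup hi : b i ≤ s.sup b)

/-- The cross term in `p ⊔ q = p + q - p * q` vanishes at each step. -/
theorem IsIdempotentElem.coe_sup_eq_sum
    (h : ∀ i ∈ s, ∀ j ∈ s, i ≠ j → (b i).1 * (b j).1 = 0) :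
    (s.sup b).1 = ∑ i ∈ s, (b i).1 := by
  classical
  induction s using Finset.induction_on with
  | empty => rfl
  | insert i s hi ih =>
    have hs := ih fun j hj k hk =>
      h j (Finset.mem_insert_of_mem hj) k (Finset.mem_insert_of_mem hk)
    rw [Finset.sup_insert, Finset.sum_insert hi, ← hs]
    change (b i).1 + (s.sup b).1 - (b i).1 * (s.sup b).1 = _
    have h₀ : ∑ j ∈ s, (b i).1 * (b j).1 = 0 := Finset.sum_eq_zero fun j hj =>
      h i (Finset.mem_insert_self _ _) j (Finset.mem_insert_of_mem hj)
        (by rintro rfl; exact hi hj)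
    rw [hs, Finset.mul_sum, h₀, sub_zero]

end Idempotents

namespace IsRepresentation

variable {S A ι : Type*} [InverseSemigroupWithZero S] [CStarAlgebra A] {ρ : S → A}
  (h : IsRepresentation ρ) {s : Finset ι} {f : ι → Idem S}

theorem onIdem_inf (e f : Idem S) : h.onIdem (e ⊓ f) = h.onIdem e ⊓ h.onIdem f :=
  Subtype.ext (Subtype.ext (h.map_mul _ _))

theorem onIdem_bot : h.onIdem ⊥ = ⊥ := Subtype.ext (Subtype.ext h.map_zero)

theorem coe_sum_onIdem : ((∑ i ∈ s, (h.onIdem (f i)).1 : h.idemAlgebra) : A) =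
    ∑ i ∈ s, ρ (f i).1 :=
  map_sum h.idemAlgebra.val _ _

theorem onIdem_le_sup {e : Idem S} (he : ρ e.1 = ∑ i ∈ s, ρ (f i).1) :
    h.onIdem e ≤ s.sup fun i => h.onIdem (f i) :=
  IsIdempotentElem.le_sup_of_eq_sum (Subtype.ext (he.trans h.coe_sum_onIdem.symm))

theorem top_le_sup_onIdem (he : 1 = ∑ i ∈ s, ρ (f i).1) :
    ⊤ ≤ s.sup fun i => h.onIdem (f i) :=
  IsIdempotentElem.le_sup_of_eq_sum (Subtype.ext (he.trans h.coe_sum_onIdem.symm))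

theorem coe_sup_onIdem (hf : ∀ i ∈ s, ∀ j ∈ s, i ≠ j → (f i).1 * (f j).1 = 0) :
    ((s.sup fun i => h.onIdem (f i)).1 : A) = ∑ i ∈ s, ρ (f i).1 := by
  rw [IsIdempotentElem.coe_sup_eq_sum, coe_sum_onIdem]
  intro i hi j hj hij
  apply Subtype.ext
  change ρ _ * ρ _ = 0
  rw [← h.map_mul, hf i hi j hj hij, h.map_zero]

end IsRepresentation

/-! ### The idempotents `(α, 1, α)` and tightness of `π` -/

namespace SelfSimilarGraph

variable {G V W : Type*} [Group G] [MulAction G V] [MulAction G W] {D : SelfSimilarGraph G V W}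

/-- The path of length one given by an edge. -/
def Path.edge (D : SelfSimilarGraph G V W) (e : W) : D.Path := ⟨D.r e, [e], rfl, trivial⟩

/-- The path `α e`. -/
def Path.snoc (α : D.Path) (e : W) (h : D.r e = α.source) : D.Path :=
  α.concat (Path.edge D e) h.symm

namespace InvSemigroup

/-- The idempotent `(α, 1, α)`. -/
def idem (α : D.Path) : Idem D.InvSemigroup :=
  ⟨triple α 1 α (one_smul _ _).symm, (triple_mul_self _ _).trans
    (triple_congr rfl (one_mul _) rfl)⟩

theorem idem_ne_bot (α : D.Path) : idem α ≠ ⊥ := fun h => by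
  have := congrArg Subtype.val h
  change triple α 1 α _ = zero at this
  cases this

/-- An idempotent acts as a partial identity on `E* × G`, while `(α, g, β)` sends `(β, 1)` to `(α,
g)`; this forces `α = β` and `g = 1`. -/
theorem eq_bot_or_idem (e : Idem D.InvSemigroup) : e = ⊥ ∨ ∃ α, e = idem α := by
  obtain ⟨e, he⟩ := e
  cases e with
  | zero => exact Or.inl rfl
  | triple α g β h =>
    have := rel_idem he (rel_base h)
    obtain ⟨h₁, h₂⟩ := Prod.ext_iff.1 this
    exact Or.inr ⟨α, Subtype.ext (triple_congr rfl h₂ h₁.symm)⟩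

theorem idem_concat_le (α ε : D.Path) (h : α.source = ε.range) :
    idem (α.concat ε h) ≤ idem α := by
  refine (triple_mul_right h (one_smul _ _).symm (one_smul _ _).symm).trans
    (triple_congr rfl ?_ ?_)
  · rw [inv_one, Path.cocycle_one, inv_one, mul_one]
  · simp only [inv_one, Path.smul_one]

theorem idem_inf_eq_bot {α β : D.Path}
    (H₁ : ¬ ∃ ε : D.Path, ∃ h' : α.source = ε.range, β = α.concat ε h')
    (H₂ : ¬ ∃ ε : D.Path, ∃ h' : β.source = ε.range, α = β.concat ε h') :
    idem α ⊓ idem β = ⊥ := Subtype.ext (triple_mul_eq_zero _ _ H₁ H₂)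

theorem concat_eq_of_length_le {α ε : D.Path} {h : α.source = ε.range}
    (hl : (α.concat ε h).edges.length ≤ α.edges.length) : α.concat ε h = α := by
  have : (α.edges ++ ε.edges).length ≤ α.edges.length := hl
  rw [List.length_append] at this
  exact Path.ext rfl ((congrArg (α.edges ++ ·)
    (List.eq_nil_of_length_eq_zero (by omega : ε.edges.length = 0))).trans (List.append_nil _))

/-- A path at least as long as `β` is comparable with `β` only if it extends it; incomparable paths
have product zero. -/
theorem idem_le_or_inf_eq_bot {α β : D.Path} (hl : β.edges.length ≤ α.edges.length) :
    idem α ≤ idem β ∨ idem α ⊓ idem β = ⊥ := by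
  by_cases H₂ : ∃ ε : D.Path, ∃ h' : β.source = ε.range, α = β.concat ε h'
  · obtain ⟨ε, h', rfl⟩ := H₂
    exact Or.inl (idem_concat_le _ _ _)
  by_cases H₁ : ∃ ε : D.Path, ∃ h' : α.source = ε.range, β = α.concat ε h'
  · obtain ⟨ε, h', rfl⟩ := H₁
    rw [concat_eq_of_length_le hl]
    exact Or.inl le_rfl
  · exact Or.inr (idem_inf_eq_bot H₁ H₂)

section Refinement

variable [Fintype V] [Fintype W] {B : Type*} [BooleanAlgebra B] {β : Idem D.InvSemigroup → B}

-- Passing from `n` to `n + 1` replaces each path by its extensions by one edge, which by `hW` does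
-- not lower the supremum.
open Classical in
theorem exists_paths_sup_eq_top (hV : ⊤ ≤ Finset.univ.sup fun x => β (idem (Path.vertex D x)))
    (hW : ∀ α : D.Path, β (idem α) ≤ Finset.univ.sup
      fun e : {e // D.r e = α.source} => β (idem (α.snoc e.1 e.2))) (n : ℕ) :
    ∃ T : Finset D.Path, ⊤ ≤ T.sup (fun α => β (idem α)) ∧ ∀ α ∈ T, α.edges.length = n := by
  induction n with
  | zero =>
    refine ⟨Finset.univ.image (Path.vertex D), ?_, ?_⟩
    · rw [Finset.sup_image]; exact hV
    · intro α hα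
      obtain ⟨x, -, rfl⟩ := Finset.mem_image.1 hα
      rfl
  | succ n ih =>
    obtain ⟨T, hT, hn⟩ := ih
    refine ⟨T.biUnion fun α => Finset.univ.image
      fun e : {e // D.r e = α.source} => α.snoc e.1 e.2, ?_, ?_⟩
    · rw [Finset.sup_biUnion]
      refine hT.trans (Finset.sup_mono_fun fun α _ => ?_)
      rw [Finset.sup_image]; exact hW α
    · intro γ hγ
      obtain ⟨α, hα, hγ⟩ := Finset.mem_biUnion.1 hγ
      obtain ⟨e, -, rfl⟩ := Finset.mem_image.1 hγ
      change (α.edges ++ [e.1]).length = _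
      rw [List.length_append, hn α hα, List.length_singleton]

-- The paths of a fixed length `n`, with `n` at least every length occurring in `F`, form the
-- refinement that the criterion asks for.
open Classical in
theorem isTightMap_of_le_sup (hinf : ∀ a b, β (a ⊓ b) = β a ⊓ β b) (hbot : β ⊥ = ⊥)
    (hV : ⊤ ≤ Finset.univ.sup fun x => β (idem (Path.vertex D x)))
    (hW : ∀ α : D.Path, β (idem α) ≤ Finset.univ.sup
      fun e : {e // D.r e = α.source} => β (idem (α.snoc e.1 e.2))) :
    IsTightMap β := by
  refine isTightMap_of_refinement hinf hbot fun F => ?_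
  have hF : ∃ n, ∀ α : D.Path, idem α ∈ F → α.edges.length ≤ n := by
    -- The path is determined by its idempotent, so the chosen one is the right one; the value `0`
    -- at `⊥` is harmless for an upper bound.
    let len : Idem D.InvSemigroup → ℕ := fun e =>
      if h : ∃ α, e = idem α then h.choose.edges.length else 0
    refine ⟨F.sup len, fun α hα => ?_⟩
    have h : ∃ α', idem α = idem α' := ⟨α, rfl⟩
    have hc : h.choose = α := by
      have := congrArg Subtype.val h.choose_spec
      change triple _ _ _ _ = triple _ _ _ _ at this
      injection this with h₁
      exact h₁.symm
    have hlen : len (idem α) = α.edges.length := by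
      simp only [len, dif_pos h, hc]
    rw [← hlen]
    exact Finset.le_sup hα
  obtain ⟨n, hn⟩ := hF
  obtain ⟨T, hT, hl⟩ := exists_paths_sup_eq_top hV hW n
  refine ⟨T.image idem, by rw [Finset.sup_image]; exact hT, fun t ht e he => ?_⟩
  obtain ⟨γ, hγ, rfl⟩ := Finset.mem_image.1 ht
  rcases eq_bot_or_idem e with rfl | ⟨α, rfl⟩
  · exact Or.inr (inf_bot_eq _)
  · exact idem_le_or_inf_eq_bot ((hn α he).trans (hl γ hγ).ge)

end Refinement

end InvSemigroup

section Algebra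

variable [Fintype V] [Fintype W]

theorem π_idem (α : D.Path) :
    D.π (InvSemigroup.idem α).1 = D.sPath α * star (D.sPath α) := by
  change D.sPath α * D.u 1 * star (D.sPath α) = _
  rw [u_one, mul_one]

theorem sPath_snoc (α : D.Path) (e : W) (h : D.r e = α.source) :
    D.sPath (α.snoc e h) = D.sPath α * D.s e := sPath_concat α (Path.edge D e) h.symm

/-- Both inequalities come from exact sums: `∑ p_x = 1`, and `s_α s_α* = s_α p_{d(α)} s_α*` with
`p_{d(α)}` expanded by the Cuntz-Krieger relation. -/
theorem isTightRepresentation_π : IsTightRepresentation D.π := by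
  classical
  refine ⟨isRepresentation_π, InvSemigroup.isTightMap_of_le_sup (IsRepresentation.onIdem_inf _)
    (IsRepresentation.onIdem_bot _) (IsRepresentation.top_le_sup_onIdem _ ?_)
    fun α => IsRepresentation.onIdem_le_sup _ ?_⟩
  · simp only [π_idem]
    rw [← D.sum_p]
    exact Finset.sum_congr rfl fun x _ =>
      ((congrArg (D.p x * ·) (D.star_p x)).trans (D.p_mul_self x)).symm
  · simp only [π_idem, sPath_snoc, star_mul]
    calc D.sPath α * star (D.sPath α)
        = D.sPath α * D.p α.source * star (D.sPath α) := by rw [sPath_mul_p]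
      _ = ∑ e : {e // D.r e = α.source},
            D.sPath α * (D.s e.1 * star (D.s e.1)) * star (D.sPath α) := by
          rw [← sum_s, Finset.mul_sum, Finset.sum_mul]
          exact Finset.sum_subtype _ (by simp)
            fun e => D.sPath α * (D.s e * star (D.s e)) * star (D.sPath α)
      _ = _ := by simp only [mul_assoc]

end Algebra

end SelfSimilarGraph

/-! ### Homomorphisms out of the free *-algebra -/

namespace FreeStarAlgebra

variable {X A : Type*} [Ring A] [StarRing A] [Algebra ℂ A] [StarModule ℂ A]

/-- The *-homomorphism from the free unital *-algebra with given values on the letters. -/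
noncomputable def lift (f : X → A) : FreeStarAlgebra X →⋆ₐ[ℂ] A :=
  let F : FreeStarAlgebra X →ₐ[ℂ] A :=
    (FreeAlgebra.lift ℂ (Sum.elim f fun x => star (f x)) : FreeAlgebra ℂ (X ⊕ X) →ₐ[ℂ] A)
  have hF (x : X) : F (of x) = f x := FreeAlgebra.lift_ι_apply _ _
  have hF' (x : X) : F (ofStar x) = star (f x) := FreeAlgebra.lift_ι_apply _ _
  { F with
    map_star' := fun a => by
      change F (star a) = star (F a)
      induction a using FreeStarAlgebra.induction with
      | algebraMap c =>
        rw [star_algebraMap, F.commutes, F.commutes]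
        exact algebraMap_star_comm c
      | of x => rw [star_of, hF, hF']
      | ofStar x => rw [← star_of, star_star, hF, star_of, hF', star_star]
      | mul a b ha hb => rw [star_mul, map_mul, map_mul, star_mul, ha, hb]
      | add a b ha hb => rw [star_add, map_add, map_add, star_add, ha, hb] }

@[simp] theorem lift_of (f : X → A) (x : X) : lift f (of x) = f x :=
  FreeAlgebra.lift_ι_apply (A := A) _ (Sum.inl x)

omit [StarModule ℂ A] in
theorem hom_ext {F F' : FreeStarAlgebra X →⋆ₐ[ℂ] A} (h : ∀ x, F (of x) = F' (of x)) (a) :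
    F a = F' a := by
  induction a using FreeStarAlgebra.induction with
  | algebraMap c => rw [AlgHomClass.commutes, AlgHomClass.commutes]
  | of x => exact h x
  | ofStar x => rw [← star_of, map_star, map_star, h]
  | mul a b ha hb => rw [map_mul, map_mul, ha, hb]
  | add a b ha hb => rw [map_add, map_add, ha, hb]

end FreeStarAlgebra

/-! ### The universal property of the completed algebra -/

namespace SelfSimilarGraph

section Universal

variable {G V W A : Type*} [Group G] [MulAction G V] [MulAction G W] [Fintype V] [Fintype W]
  {D : SelfSimilarGraph G V W} [CStarAlgebra A]

/-- The C*-seminorm induced by a *-homomorphism for which the defining relations hold. -/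
noncomputable def AdmissibleSeminorm.ofHom (F : FreeStarAlgebra (Gen G V W) →⋆ₐ[ℂ] A)
    (hF : ∀ a b, D.Relator a b → F a = F b) : D.AdmissibleSeminorm where
  toFun a := ‖F a‖
  map_zero' := by rw [map_zero, norm_zero]
  add_le' a b := by rw [map_add]; exact norm_add_le _ _
  neg' a := by rw [map_neg, norm_neg]
  smul' c a := by rw [map_smul, norm_smul]
  mul_le a b := by
    change ‖F (a * b)‖ ≤ ‖F a‖ * ‖F b‖
    rw [map_mul]; exact norm_mul_le _ _
  star_mul_self a := by
    change ‖F (star a * a)‖ = ‖F a‖ * ‖F a‖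
    rw [map_mul, map_star]; exact CStarRing.norm_star_mul_self
  relator a b h := by
    change ‖F (a - b)‖ = 0
    rw [map_sub, hF a b h, sub_self, norm_zero]

/-- The seminorm `‖F a‖` is admissible, hence dominated by the maximal one. So `F` is contractive
and extends to the completion; compatibility with the adjoint follows by density. -/
theorem exists_lift (F : FreeStarAlgebra (Gen G V W) →⋆ₐ[ℂ] A)
    (hF : ∀ a b, D.Relator a b → F a = F b) :
    ∃ ψ : D.O →⋆ₐ[ℂ] A, ∀ a, ψ (D.toOHom a) = F a := by
  let F₀ : D.PreO →+* A := (F : FreeStarAlgebra (Gen G V W) →+* A)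
  have hc : Continuous F₀ := AddMonoidHomClass.continuous_of_bound F₀ 1 fun a => by
    rw [one_mul]
    exact D.le_maxNorm (AdmissibleSeminorm.ofHom F hF) a
  let Ψ : D.O →+* A := UniformSpace.Completion.extensionHom F₀ hc
  have hΨ : Continuous Ψ := UniformSpace.Completion.continuous_extension
  have hcoe (a : FreeStarAlgebra (Gen G V W)) : Ψ (D.toOHom a) = F a :=
    UniformSpace.Completion.extensionHom_coe F₀ hc a
  refine ⟨{ Ψ with
    commutes' := fun c => ?_
    map_star' := fun x => ?_ }, hcoe⟩
  · change Ψ (algebraMap ℂ D.O c) = _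
    rw [← AlgHomClass.commutes D.toOHom c, hcoe, AlgHomClass.commutes]
  · change Ψ (star x) = star (Ψ x)
    refine D.denseRange_toOHom.induction_on
      (p := fun x => Ψ (star x) = star (Ψ x)) x ?_ fun a => ?_
    · exact isClosed_eq (hΨ.comp continuous_star) hΨ.star
    · rw [← toOHom_star, hcoe, hcoe, map_star]

-- *-homomorphisms of C*-algebras are continuous, and *-polynomials in the generators are dense.
open scoped CStarAlgebra in
theorem O_hom_ext {ψ ψ' : D.O →⋆ₐ[ℂ] A} (hp : ∀ x, ψ (D.p x) = ψ' (D.p x))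
    (hs : ∀ e, ψ (D.s e) = ψ' (D.s e)) (hu : ∀ g, ψ (D.u g) = ψ' (D.u g)) : ψ = ψ' := by
  have h := FreeStarAlgebra.hom_ext (F := ψ.comp D.toOHom) (F' := ψ'.comp D.toOHom) fun y => by
    cases y with
    | p x => exact hp x
    | s e => exact hs e
    | u g => exact hu g
  refine DFunLike.coe_injective (D.denseRange_toOHom.equalizer ?_ ?_ (funext h))
  · exact map_continuous ψ
  · exact map_continuous ψ'

end Universal

/-! ### The generators inside the inverse semigroup, and the two covers -/

namespace InvSemigroup

variable {G V W : Type*} [Group G] [MulAction G V] [MulAction G W] {D : SelfSimilarGraph G V W}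

theorem triple_mul_of_eq {α β γ δ : D.Path} {g k : G} {h : α.source = g • β.source}
    {h₂ : γ.source = k • δ.source} (e : β = γ) :
    triple α g β h * triple γ k δ h₂ = triple α (g * k) δ (by rw [h, e, h₂, mul_smul]) := by
  subst e
  exact triple_mul_self h h₂

theorem triple_mul_eq_zero_of_range_ne {α β γ δ : D.Path} {g k : G}
    {h : α.source = g • β.source} {h₂ : γ.source = k • δ.source} (e : β.range ≠ γ.range) :
    triple α g β h * triple γ k δ h₂ = 0 :=
  triple_mul_eq_zero h h₂ (fun ⟨_, _, H⟩ => e (congrArg Path.range H).symm)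
    (fun ⟨_, _, H⟩ => e (H ▸ rfl))

theorem idem_inf_eq_bot_of_length_eq {α β : D.Path} (hl : α.edges.length = β.edges.length)
    (hne : α ≠ β) : idem α ⊓ idem β = ⊥ := by
  refine idem_inf_eq_bot ?_ ?_
  · rintro ⟨ε, h', rfl⟩
    exact hne (concat_eq_of_length_le hl.ge).symm
  · rintro ⟨ε, h', rfl⟩
    exact hne (concat_eq_of_length_le hl.le)

theorem idem_le_vertex (α : D.Path) : idem α ≤ idem (Path.vertex D α.range) :=
  idem_concat_le (Path.vertex D α.range) α rfl

theorem range_eq_of_idem_le_vertex {α : D.Path} {x : V} (h : idem α ≤ idem (Path.vertex D x)) :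
    α.range = x := by
  by_contra hne
  refine idem_ne_bot α (le_bot_iff.1 ((le_inf le_rfl h).trans (le_of_eq ?_)))
  exact Subtype.ext (triple_mul_eq_zero_of_range_ne hne)

/-- The triple `(α, 1, d(α))`. -/
def ofPath (α : D.Path) : D.InvSemigroup :=
  triple α 1 (Path.vertex D α.source) (one_smul _ _).symm

/-- The triple `(g x, g, x)`. -/
def unit (D : SelfSimilarGraph G V W) (g : G) (x : V) : D.InvSemigroup :=
  triple (Path.vertex D (g • x)) g (Path.vertex D x) rfl

theorem star_idem (α : D.Path) : star (idem α).1 = (idem α).1 :=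
  triple_congr rfl inv_one rfl

theorem idem_vertex (x : V) : (idem (Path.vertex D x)).1 = unit D 1 x :=
  triple_congr (congrArg _ (one_smul G x).symm) rfl rfl

theorem star_ofPath_mul_self (α : D.Path) :
    star (ofPath α) * ofPath α = (idem (Path.vertex D α.source)).1 :=
  (triple_mul_of_eq rfl).trans (triple_congr rfl (by rw [inv_one, one_mul]) rfl)

theorem ofPath_mul_star (α : D.Path) : ofPath α * star (ofPath α) = (idem α).1 :=
  (triple_mul_of_eq rfl).trans (triple_congr rfl (by rw [inv_one, one_mul]) rfl)

/-- The triples `(gx, g, x)` compose like arrows `x → gx` of the transformation groupoid; this makes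
their sum over `x` multiplicative in `g`. -/
theorem unit_mul_unit (g h : G) (x : V) : unit D g (h • x) * unit D h x = unit D (g * h) x :=
  (triple_mul_of_eq rfl).trans (triple_congr (congrArg _ (mul_smul g h x).symm) rfl rfl)

theorem unit_mul_unit_of_ne (g h : G) {x y : V} (hxy : y ≠ h • x) :
    unit D g y * unit D h x = 0 := triple_mul_eq_zero_of_range_ne hxy

theorem star_unit (g : G) (x : V) : star (unit D g x) = unit D g⁻¹ (g • x) :=
  triple_congr (congrArg _ (inv_smul_smul g x).symm) rfl rfl

theorem ofPath_mul_unit (α : D.Path) {g : G} {x : V} (h : α.source = g • x) :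
    ofPath α * unit D g x = triple α g (Path.vertex D x) h :=
  (triple_mul_of_eq (congrArg _ h)).trans (triple_congr rfl (one_mul g) rfl)

theorem ofPath_mul_unit_of_ne (α : D.Path) {g : G} {x : V} (h : α.source ≠ g • x) :
    ofPath α * unit D g x = 0 := triple_mul_eq_zero_of_range_ne h

/-- The semigroup form of `u_g s_α = s_{gα} u_{φ(g,α)}`: the right side also factors as `(gα, 1,
d(gα))` times the unit of `φ(g,α)` at `d(α)`. -/
theorem unit_mul_ofPath (g : G) (α : D.Path) :
    unit D g α.range * ofPath α =
      triple (α.smul g) (α.cocycle g) (Path.vertex D α.source)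
        ((Path.source_smul g α).trans (Path.cocycle_smul g α _).symm) :=
  (triple_mul_left (α := Path.vertex D (g • α.range)) (g := g) (β := Path.vertex D α.range)
    (ε := α) (δ := Path.vertex D α.source) rfl rfl (one_smul _ _).symm).trans
    (triple_congr rfl (mul_one _) rfl)

theorem unit_mul_ofPath_of_ne (g : G) (α : D.Path) {x : V} (h : x ≠ α.range) :
    unit D g x * ofPath α = 0 := triple_mul_eq_zero_of_range_ne h

theorem ofPath_mul_ofPath (α β : D.Path) (h : α.source = β.range) :
    ofPath α * ofPath β = ofPath (α.concat β h) := by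
  have h₂ : ((Path.vertex D α.source).concat β h).source =
      (1 : G) • (Path.vertex D β.source).source :=
    (Path.source_concat _ _ _).trans (one_smul _ _).symm
  -- Writing `β` as an extension of the vertex `d(α)` brings the product into the case `γ = βε`.
  have e : ofPath β = triple ((Path.vertex D α.source).concat β h) 1
      (Path.vertex D β.source) h₂ := triple_congr (Path.ext h.symm rfl) rfl rfl
  rw [e]
  refine (triple_mul_left (α := α) (β := Path.vertex D α.source) (one_smul _ _).symm h h₂).trans
    (triple_congr (Path.ext rfl ?_) ?_ (congrArg (Path.vertex D) (Path.source_concat α β h).symm))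
  · change α.edges ++ D.listSMul 1 β.edges = α.edges ++ β.edges
    rw [listSMul_one]
  · rw [Path.cocycle_one, one_mul]

section Covers

variable [Fintype V] [Fintype W]

omit [Fintype W] in
-- With `X = Y = ∅` the relative cut is the whole semilattice, and `(α, 1, α)` lies below its range
-- vertex.
open Classical in
theorem isCover_vertices :
    IsCover ((Finset.univ.image fun x => idem (Path.vertex D x) :
      Finset (Idem D.InvSemigroup)) : Set (Idem D.InvSemigroup))
      (relativeCut (∅ : Finset (Idem D.InvSemigroup)) ∅) := by
  refine ⟨fun z _ => ⟨by simp, by simp⟩, fun y _ hy => ?_⟩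
  obtain ⟨α, rfl⟩ := (eq_bot_or_idem y).resolve_left hy
  refine ⟨idem (Path.vertex D α.range), by simp, ?_⟩
  rw [inf_eq_right.2 (idem_le_vertex α)]
  exact hy

omit [Fintype V] in
open Classical in
theorem isCover_edges (x : V) :
    IsCover (((Finset.univ.filter fun e => D.r e = x).image fun e => idem (Path.edge D e) :
      Finset (Idem D.InvSemigroup)) : Set (Idem D.InvSemigroup))
      (relativeCut ({idem (Path.vertex D x)} : Finset (Idem D.InvSemigroup)) ∅) := by
  constructor
  · intro z hz
    obtain ⟨e, he, rfl⟩ := Finset.mem_image.1 (Finset.mem_coe.1 hz)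
    obtain rfl := (Finset.mem_filter.1 he).2
    refine ⟨fun y hy => ?_, by simp⟩
    rw [Finset.mem_singleton.1 hy]
    exact idem_le_vertex (Path.edge D e)
  · intro y hy hy0
    obtain ⟨α, rfl⟩ := (eq_bot_or_idem y).resolve_left hy0
    have hα := range_eq_of_idem_le_vertex (hy.1 _ (Finset.mem_singleton_self _))
    obtain ⟨y, l, hl⟩ := α
    obtain rfl : y = x := hα
    cases l with
    | nil =>
      -- For the vertex itself the absence of sources supplies an edge below it; a longer path
      -- instead lies below its own first edge.
      obtain ⟨e, rfl⟩ := D.no_sources y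
      refine ⟨idem (Path.edge D e), Finset.mem_coe.2 (Finset.mem_image_of_mem _ (by simp)), ?_⟩
      have := inf_eq_left.2 (idem_le_vertex (Path.edge D e))
      exact fun h => idem_ne_bot (Path.edge D e) (this.symm.trans h)
    | cons e l =>
      refine ⟨idem (Path.edge D e), Finset.mem_coe.2 (Finset.mem_image_of_mem _ (by simp [hl.1])),
        ?_⟩
      have hc : (⟨y, e :: l, hl⟩ : D.Path) = (Path.edge D e).concat ⟨D.d e, l, hl.2⟩ rfl :=
        Path.ext hl.1.symm rfl
      rw [hc]
      have := inf_eq_right.2 (idem_concat_le (Path.edge D e) ⟨D.d e, l, hl.2⟩ rfl)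
      exact fun h => idem_ne_bot _ (this.symm.trans h)

end Covers

end InvSemigroup

/-! ### From a tight representation to a homomorphism -/

section TightRepresentation

open InvSemigroup

variable {G V W A : Type*} [Group G] [MulAction G V] [MulAction G W] [Fintype V] [Fintype W]
  {D : SelfSimilarGraph G V W} [CStarAlgebra A] {ρ : D.InvSemigroup → A}

-- Tightness for the vertex cover bounds `1` by the supremum of the vertex projections, and their
-- orthogonality makes the supremum a sum.
omit [Fintype W] in
theorem sum_vertices_of_tight (hρ : IsTightRepresentation ρ) :
    ∑ x, ρ (idem (Path.vertex D x)).1 = 1 := by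
  classical
  obtain ⟨h, ht⟩ := hρ
  have h₁ := ht _ _ _ isCover_vertices
  rw [Finset.sup_image, Finset.inf_empty, Finset.inf_empty, top_inf_eq, top_le_iff] at h₁
  rw [← h.coe_sup_onIdem]
  · exact congrArg (fun a : h.Proj => (a.1 : A)) h₁
  · intro x _ y _ hxy
    exact congrArg Subtype.val (idem_inf_eq_bot_of_length_eq
      (α := Path.vertex D x) (β := Path.vertex D y) rfl fun H => hxy (congrArg Path.range H))

-- Tightness gives one inequality and monotonicity the other; distinct edges being orthogonal, the
-- supremum is a sum.
omit [Fintype V] in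
open Classical in
theorem sum_edges_of_tight (hρ : IsTightRepresentation ρ) (x : V) :
    ∑ e with D.r e = x, ρ (idem (Path.edge D e)).1 = ρ (idem (Path.vertex D x)).1 := by
  obtain ⟨h, ht⟩ := hρ
  have h₁ := ht _ _ _ (isCover_edges x)
  rw [Finset.sup_image, Finset.inf_singleton, Finset.inf_empty, inf_top_eq] at h₁
  rw [← h.coe_sup_onIdem]
  · refine congrArg (fun a : h.Proj => (a.1 : A)) (le_antisymm (Finset.sup_le fun e he => ?_) h₁)
    obtain rfl := (Finset.mem_filter.1 he).2
    rw [Function.comp_apply, ← inf_eq_left, ← h.onIdem_inf, inf_eq_left.2]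
    exact idem_le_vertex (Path.edge D e)
  · intro e _ f _ hef
    exact congrArg Subtype.val (idem_inf_eq_bot_of_length_eq
      (α := Path.edge D e) (β := Path.edge D f) rfl
      fun H => hef (List.cons.inj (congrArg Path.edges H)).1)

/-- The images of the generators of the C*-algebra under a representation. -/
noncomputable def genValue (ρ : D.InvSemigroup → A) : Gen G V W → A
  | .p x => ρ (idem (Path.vertex D x)).1
  | .s e => ρ (ofPath (Path.edge D e))
  | .u g => ∑ x, ρ (unit D g x)

omit [Fintype W] in
theorem sum_unit_mul_unit (h : IsRepresentation ρ) (g k : G) :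
    (∑ x, ρ (unit D g x)) * ∑ x, ρ (unit D k x) = ∑ x, ρ (unit D (g * k) x) := by
  rw [Finset.mul_sum]
  refine Finset.sum_congr rfl fun x _ => ?_
  rw [Finset.sum_mul, Finset.sum_eq_single (k • x), ← h.map_mul, unit_mul_unit]
  · intro y _ hy
    rw [← h.map_mul, unit_mul_unit_of_ne g k hy, h.map_zero]
  · simp

omit [Fintype W] in
theorem sum_unit_one (hρ : IsTightRepresentation ρ) : ∑ x, ρ (unit D 1 x) = 1 := by
  rw [← sum_vertices_of_tight hρ]
  exact Finset.sum_congr rfl fun x _ => by rw [idem_vertex]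

omit [Fintype W] in
theorem star_sum_unit (h : IsRepresentation ρ) (g : G) :
    star (∑ x, ρ (unit D g x)) = ∑ x, ρ (unit D g⁻¹ x) := by
  rw [star_sum, ← Equiv.sum_comp (MulAction.toPerm g) fun x => ρ (unit D g⁻¹ x)]
  exact Finset.sum_congr rfl fun x _ => by rw [← h.map_star, star_unit]; rfl

-- Only `x = r(α)` contributes on the left and only `x = d(α)` on the right. Allowing any path
-- covers both commutation relations of `u_g`, with `s_e` and with `p_x`.
omit [Fintype W] in
theorem sum_unit_mul_ofPath (h : IsRepresentation ρ) (g : G) (α : D.Path) :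
    (∑ x, ρ (unit D g x)) * ρ (ofPath α) =
      ρ (ofPath (α.smul g)) * ∑ x, ρ (unit D (α.cocycle g) x) := by
  have hs : (α.smul g).source = α.cocycle g • α.source :=
    (Path.source_smul g α).trans (Path.cocycle_smul g α _).symm
  rw [Finset.sum_mul, Finset.sum_eq_single α.range, Finset.mul_sum,
    Finset.sum_eq_single α.source, ← h.map_mul, ← h.map_mul, unit_mul_ofPath,
    ofPath_mul_unit _ hs]
  · intro x _ hx
    rw [← h.map_mul, ofPath_mul_unit_of_ne, h.map_zero]
    rw [hs]
    exact fun H => hx (smul_left_cancel _ H).symm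
  · simp
  · intro x _ hx
    rw [← h.map_mul, unit_mul_ofPath_of_ne g α hx, h.map_zero]
  · simp

/-- Tightness enters only through the two sum relations and the identity `u_1 = 1`, on which
unitarity depends; the other relations hold for every representation. -/
theorem lift_genValue_relator (hρ : IsTightRepresentation ρ)
    {a b : FreeStarAlgebra (Gen G V W)} (hab : D.Relator a b) :
    FreeStarAlgebra.lift (genValue ρ) a = FreeStarAlgebra.lift (genValue ρ) b := by
  classical
  have h : IsRepresentation ρ := hρ.1
  have hp (x) : FreeStarAlgebra.lift (genValue ρ) (pF G W x) = ρ (idem (Path.vertex D x)).1 :=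
    FreeStarAlgebra.lift_of _ _
  have hs (e) : FreeStarAlgebra.lift (genValue ρ) (sF G V e) = ρ (ofPath (Path.edge D e)) :=
    FreeStarAlgebra.lift_of _ _
  have hu (g) : FreeStarAlgebra.lift (genValue ρ) (uF V W g) = ∑ x, ρ (unit D g x) :=
    FreeStarAlgebra.lift_of _ _
  cases hab with
  | p_star x => rw [map_star, hp, ← h.map_star, star_idem]
  | p_mul_self x => rw [map_mul, hp, ← h.map_mul, (idem _).2.eq]
  | p_mul x y hxy =>
    rw [map_mul, hp, hp, ← h.map_mul, map_zero]
    exact (congrArg ρ (triple_mul_eq_zero_of_range_ne hxy)).trans h.map_zero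
  | sum_p => simp only [map_sum, hp, map_one, sum_vertices_of_tight hρ]
  | s_mul_star_mul e =>
    rw [map_mul, map_mul, map_star, hs, ← h.map_star, ← h.map_mul, ← h.map_mul,
      InverseSemigroupWithZero.mul_star_mul]
  | star_s_mul e =>
    rw [map_mul, map_star, hs, hp, ← h.map_star, ← h.map_mul, star_ofPath_mul_self]; rfl
  | sum_s x =>
    simp only [map_sum, map_mul, map_star, hs, hp, ← h.map_star, ← h.map_mul, ofPath_mul_star]
    exact sum_edges_of_tight hρ x
  | u_one => rw [hu, map_one, sum_unit_one hρ]
  | u_mul g k => rw [map_mul, hu, hu, hu, sum_unit_mul_unit h]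
  | star_u_mul g =>
    rw [map_mul, map_star, hu, star_sum_unit h, sum_unit_mul_unit h, inv_mul_cancel,
      sum_unit_one hρ, map_one]
  | u_mul_star g =>
    rw [map_mul, map_star, hu, star_sum_unit h, sum_unit_mul_unit h, mul_inv_cancel,
      sum_unit_one hρ, map_one]
  | u_s g e =>
    rw [map_mul, map_mul, hu, hs, hs, hu, sum_unit_mul_ofPath h]
    congr 3
    exact Path.ext (D.r_smul g e).symm rfl
  | u_p g x =>
    rw [map_mul, map_mul, hu, hp, hp]
    exact sum_unit_mul_ofPath h g (Path.vertex D x)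

theorem hom_sList {ψ : D.O →⋆ₐ[ℂ] A} (h : IsRepresentation ρ)
    (hp : ∀ x, ψ (D.p x) = ρ (idem (Path.vertex D x)).1)
    (hs : ∀ e, ψ (D.s e) = ρ (ofPath (Path.edge D e))) {l : List W} :
    ∀ {x : V} (hl : D.IsPath x l), ψ (sList D x l) = ρ (ofPath ⟨x, l, hl⟩) := by
  induction l with
  | nil => exact fun _ => hp _
  | cons e l ih =>
    intro x hl
    rw [sList_cons, map_mul, hs, ih hl.2, ← h.map_mul,
      ofPath_mul_ofPath (Path.edge D e) ⟨D.d e, l, hl.2⟩ rfl]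
    congr 2
    exact Path.ext hl.1 rfl

/-- In the image of `s_α u_g s_β*`, with `u_g` expanded as a sum over vertices, only the vertex
`d(β)` survives, and the remaining product of three triples is `(α, g, β)`. -/
theorem hom_π {ψ : D.O →⋆ₐ[ℂ] A} (h : IsRepresentation ρ)
    (hp : ∀ x, ψ (D.p x) = ρ (idem (Path.vertex D x)).1)
    (hs : ∀ e, ψ (D.s e) = ρ (ofPath (Path.edge D e)))
    (hu : ∀ g, ψ (D.u g) = ∑ x, ρ (unit D g x)) (s : D.InvSemigroup) : ψ (D.π s) = ρ s := by
  cases s with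
  | zero => exact (map_zero ψ).trans h.map_zero.symm
  | triple α g β hαβ =>
    have hα (α : D.Path) : ψ (D.sPath α) = ρ (ofPath α) := hom_sList h hp hs α.isPath
    rw [π_triple, map_mul, map_mul, map_star, hα, hα, hu, ← h.map_star, Finset.mul_sum,
      Finset.sum_mul, Finset.sum_eq_single β.source]
    · rw [← h.map_mul, ofPath_mul_unit α hαβ, ← h.map_mul]
      congr 1
      exact (triple_mul_of_eq rfl).trans (triple_congr rfl (by rw [inv_one, mul_one]) rfl)
    · intro x _ hx
      rw [mul_assoc, ← h.map_mul (unit D g x)]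
      have : unit D g x * star (ofPath β) = 0 := triple_mul_eq_zero_of_range_ne hx
      rw [this, h.map_zero, mul_zero]
    · simp

theorem π_ofPath (α : D.Path) : D.π (ofPath α) = D.sPath α := by
  change D.sPath α * D.u 1 * star (D.p α.source) = _
  rw [u_one, mul_one, star_p, sPath_mul_p]

/-- Each summand is `u_g p_x`, and `∑ p_x = 1`. Uniqueness of `ψ` uses this to recover `u_g` from
the values of `π`. -/
theorem sum_π_unit (g : G) : ∑ x, D.π (unit D g x) = D.u g := by
  have (x : V) : D.π (unit D g x) = D.u g * D.p x := by
    change D.p (g • x) * D.u g * star (D.p x) = _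
    rw [star_p, ← u_mul_p, mul_assoc, p_mul_self]
  simp only [this]
  rw [← Finset.mul_sum, sum_p, mul_one]

end TightRepresentation

end SelfSimilarGraph

/-- For a finite graph without sources, an action of `G` on it and a one-cocycle, the map
`π(α, g, β) = s_α u_g s_β*` is a tight representation of the inverse semigroup, and it is
universal among tight representations in unital C*-algebras. -/
theorem theorem6p3 {G : Type u₁} {V : Type u₂} {W : Type u₃} [Group G] [Fintype V] [Fintype W]
    [MulAction G V] [MulAction G W] (D : SelfSimilarGraph G V W) :
    IsTightRepresentation D.π ∧
      ∀ (A : Type w) [CStarAlgebra A] (ρ : D.InvSemigroup → A), IsTightRepresentation ρ →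
        ∃! ψ : D.O →⋆ₐ[ℂ] A, ∀ s, ψ (D.π s) = ρ s := by
  open SelfSimilarGraph in
  refine ⟨isTightRepresentation_π, fun A _ ρ hρ => ?_⟩
  obtain ⟨ψ, hψ⟩ := exists_lift (D := D) (FreeStarAlgebra.lift (genValue ρ))
    fun a b hab => lift_genValue_relator hρ hab
  have hgen (y : Gen G V W) : ψ (D.toOHom (.of y)) = genValue ρ y :=
    (hψ _).trans (FreeStarAlgebra.lift_of _ _)
  have hπ : ∀ s, ψ (D.π s) = ρ s :=
    hom_π hρ.1 (fun x => hgen (.p x)) (fun e => hgen (.s e)) (fun g => hgen (.u g))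
  refine ⟨ψ, hπ, fun ψ' hψ' => ?_⟩
  have hagree (s) : ψ' (D.π s) = ψ (D.π s) := (hψ' s).trans (hπ s).symm
  refine O_hom_ext (fun x => ?_) (fun e => ?_) fun g => ?_
  · have := hagree (InvSemigroup.ofPath (Path.vertex D x))
    rwa [π_ofPath] at this
  · have := hagree (InvSemigroup.ofPath (Path.edge D e))
    rwa [π_ofPath] at this
  · rw [← sum_π_unit, map_sum, map_sum]
    exact Finset.sum_congr rfl fun x _ => hagree _
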